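/- Let $\alpha\in(0,1)$ and let $\Omega\subset\mathbb R^3$ be a bounded open set with boundary $\Gamma=\partial\Omega$ of class $C^{2,\alpha}$ (near each boundary point and in suitable Cartesian coordinates, $\Omega$ is the set of points below the graph of a $C^{2,\alpha}$ function) and with connected exterior $\mathbb R^3\setminus\overline\Omega$. Let $\nu$ be the outward unit normal on $\Gamma$ and $ds$ the surface measure. Let $C^{0,\alpha}(\Gamma,\mathbb C^3)$ be the Hölder space with norm $\sum_{i=1}^3\big(\|f_i\|_{C(\Gamma)}+[f_i]_{C^{0,\alpha}(\Gamma)}\big)$, and $C^{1,\alpha}(\Gamma,\mathbb C^3)$ the space of functions whose components have a surface gradient $\nabla_\Gamma f_i\in C^{0,\alpha}(\Gamma,\mathbb C^3)$, with norm $\sum_{i=1}^3\big(\|f_i\|_{C(\Gamma)}+\|\nabla_\Gamma f_i\|_{C^{0,\alpha}(\Gamma,\mathbb C^3)}\big)$. Let $$S_0u(x)=\int_\Gamma\frac{u(y)}{4\pi|x-y|}\,ds(y),\qquad x\in\Gamma,$$ be the scalar Laplace single-layer operator, let $\mathbf S_0$ be the operator that applies $S_0$ to each of the three components of a vector density, and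 put $P_\nu\varphi=(\nu\cdot\varphi)\nu$, $P_t\varphi=\varphi-(\nu\cdot\varphi)\nu$, where $a\cdot b=\sum_i a_ib_i$. For $\varphi\in C^{0,\alpha}(\Gamma,\mathbb C^3)$ define $$C_\nu\varphi=\nu\,S_0(\nu\cdot\varphi)-\mathbf S_0P_\nu\varphi,\qquad C_t\varphi=P_t\mathbf S_0\varphi-\mathbf S_0P_t\varphi .$$ Then the integral defining $S_0u(x)$ converges absolutely for every $u\in C(\Gamma)$ and $x\in\Gamma$, and for all $\varphi\in C^{0,\alpha}(\Gamma,\mathbb C^3)$ and $x\in\Gamma$ $$C_\nu\varphi(x)=\int_\Gamma\frac{\nu(y)\cdot\varphi(y)}{4\pi|x-y|}\,\{\nu(x)-\nu(y)\}\,ds(y),$$ $$C_t\varphi(x)=-\int_\Gamma\frac{1}{4\pi|x-y|}\,\{(\varphi(y)\cdot\nu(x))\,\nu(x)-(\varphi(y)\cdot\nu(y))\,\nu(y)\}\,ds(y),$$ where both integrals converge absolutely. Moreover, $C_\nu$ and $C_t$ are well-defined compact linear operators from $C^{0,\alpha}(\Gamma,\mathbb C^3)$ to $C^{1,\alpha}(\Gamma,\mathbb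 C^3)$. -/

import Mathlib

open MeasureTheory Filter Topology Asymptotics
open scoped NNReal ENNReal

/-- Euclidean space `ℝ³`. -/
abbrev E3 : Type := EuclideanSpace ℝ (Fin 3)

/-- Euclidean plane `ℝ²`. -/
abbrev E2 : Type := EuclideanSpace ℝ (Fin 2)

/-- The embedding `ℝ³ → ℂ³`. -/
noncomputable def toC3 (n : E3) : Fin 3 → ℂ := fun i => (n i : ℂ)

/-- The bilinear dot product `n · v` of a real vector `n` and a complex vector `v`. -/
noncomputable def cdot (n : E3) (v : Fin 3 → ℂ) : ℂ := ∑ i, (n i : ℂ) * v i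

theorem cdot_add_left (v w : E3) (g : Fin 3 → ℂ) : cdot (v + w) g = cdot v g + cdot w g := by
  simp [cdot, add_mul, Finset.sum_add_distrib]

theorem cdot_smul_left (c : ℝ) (v : E3) (g : Fin 3 → ℂ) : cdot (c • v) g = c * cdot v g := by
  simp [cdot, mul_assoc, Finset.mul_sum]

theorem cdot_add_right (v : E3) (g h : Fin 3 → ℂ) : cdot v (g + h) = cdot v g + cdot v h := by
  simp [cdot, mul_add, Finset.sum_add_distrib]

theorem cdot_sub_right (v : E3) (g h : Fin 3 → ℂ) : cdot v (g - h) = cdot v g - cdot v h := by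
  simp [cdot, mul_sub, Finset.sum_sub_distrib]

theorem cdot_smul_right (v : E3) (c : ℂ) (g : Fin 3 → ℂ) : cdot v (c • g) = c * cdot v g := by
  simp [cdot, Finset.mul_sum, mul_left_comm]

section HolderSpace

variable (X : Type) [MetricSpace X] [CompactSpace X] (α : ℝ≥0)

/-- The `α`-Hölder continuous complex functions on a compact metric space, as a subspace of
the continuous functions. -/
def holderSubmodule : Submodule ℂ C(X, ℂ) where
  carrier := {f | MemHolder α f}
  add_mem' := fun {f g} hf hg => by
    exact MemHolder.add (f := f) (g := g) hf hg
  zero_mem' := by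
    exact (memHolder_const (r := α) (c := (0 : ℂ)) : MemHolder α (Function.const X (0 : ℂ)))
  smul_mem' := fun c f hf => by
    simpa using MemHolder.smul (c := c) (f := f) hf

/-- The Hölder space `C^{0,α}(X)` of complex functions; its norm (defined below) is
`‖f‖_{C(X)} + [f]_{C^{0,α}(X)}`. -/
def HolderC0 : Type := holderSubmodule X α

namespace HolderC0

variable {X α}

noncomputable instance : AddCommGroup (HolderC0 X α) :=
  inferInstanceAs (AddCommGroup (holderSubmodule X α))

noncomputable instance : Module ℂ (HolderC0 X α) :=
  inferInstanceAs (Module ℂ (holderSubmodule X α))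

/-- The underlying continuous function. -/
def toCont (f : HolderC0 X α) : C(X, ℂ) := f.1

noncomputable instance : CoeFun (HolderC0 X α) (fun _ => X → ℂ) := ⟨fun f => f.toCont⟩

theorem memHolder (f : HolderC0 X α) : MemHolder α (f : X → ℂ) := f.2

noncomputable instance : Norm (HolderC0 X α) :=
  ⟨fun f => ‖f.toCont‖ + (nnHolderNorm α (f : X → ℂ) : ℝ)⟩

theorem norm_def (f : HolderC0 X α) :
    ‖f‖ = ‖f.toCont‖ + (nnHolderNorm α (f : X → ℂ) : ℝ) := rfl

theorem toCont_add (f g : HolderC0 X α) : (f + g).toCont = f.toCont + g.toCont := rfl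

theorem toCont_smul (c : ℂ) (f : HolderC0 X α) : (c • f).toCont = c • f.toCont := rfl

theorem normCore : NormedSpace.Core ℂ (HolderC0 X α) where
  norm_nonneg f := by rw [norm_def]; positivity
  norm_smul c f := by
    have h := f.memHolder.nnHolderNorm_smul c
    rw [norm_def, norm_def, toCont_smul, norm_smul, ContinuousMap.coe_smul, h, mul_add]
    simp
  norm_triangle f g := by
    have h := f.memHolder.nnHolderNorm_add_le g.memHolder
    have h' := norm_add_le f.toCont g.toCont
    have h2 : (nnHolderNorm α (⇑f.toCont + ⇑g.toCont) : ℝ) ≤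
        nnHolderNorm α (f : X → ℂ) + nnHolderNorm α (g : X → ℂ) := by exact_mod_cast h
    rw [norm_def, norm_def, norm_def, toCont_add, ContinuousMap.coe_add]
    linarith
  norm_eq_zero_iff f := by
    constructor
    · intro h
      rw [norm_def] at h
      have h0 : ‖f.toCont‖ = 0 :=
        le_antisymm (by have := NNReal.coe_nonneg (nnHolderNorm α (f : X → ℂ)); linarith)
          (norm_nonneg _)
      exact Subtype.ext (norm_eq_zero.mp h0)
    · rintro rfl
      have h0 : (0 : HolderC0 X α).toCont = 0 := rfl
      have h1 : nnHolderNorm α ((0 : HolderC0 X α) : X → ℂ) = 0 := by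
        rw [h0, ContinuousMap.coe_zero]
        exact nnHolderNorm_const X α (0 : ℂ)
      rw [norm_def, h0, norm_zero, zero_add, ← h0, h1, NNReal.coe_zero]

noncomputable instance : NormedAddCommGroup (HolderC0 X α) := .ofCore normCore

noncomputable instance : NormedSpace ℂ (HolderC0 X α) := .ofCore normCore

end HolderC0

/-- The space `C^{0,α}(X, ℂ³)`, with norm `∑ᵢ (‖fᵢ‖_{C(X)} + [fᵢ]_{C^{0,α}(X)})`. -/
abbrev HolderC0Vec : Type := PiLp 1 (fun _ : Fin 3 => HolderC0 X α)

variable {X α}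

/-- The `ℂ³`-valued function on `X` given by an element of `C^{0,α}(X, ℂ³)`. -/
noncomputable def HolderC0Vec.toFun (φ : HolderC0Vec X α) : X → Fin 3 → ℂ := fun x i => φ i x

end HolderSpace

/-- A bounded open set `Ω ⊆ ℝ³` with connected exterior and with boundary of class `C^{2,α}`:
near every boundary point and in suitable Cartesian coordinates, `Ω` is the set of points below
the graph of a `C^{2,α}` function of two variables (such a function, given near one point, may be
multiplied by a smooth cut-off, so it is taken to be defined on the whole plane). -/
structure HolderDomain (α : ℝ≥0) where
  /-- the set `Ω` -/
  carrier : Set E3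
  isOpen : IsOpen carrier
  isBounded : Bornology.IsBounded carrier
  exterior_connected : IsConnected (closure carrier)ᶜ
  local_graph : ∀ p ∈ frontier carrier,
    ∃ (e : E3 ≃ᵃⁱ[ℝ] WithLp 2 (E2 × ℝ)) (f : E2 → ℝ) (W : Set E3),
      ContDiff ℝ 2 f ∧ MemHolder α (fderiv ℝ (fderiv ℝ f)) ∧ IsOpen W ∧ p ∈ W ∧
      ∀ y ∈ W, (y ∈ carrier ↔ (e y).snd < f (e y).fst)

/-- `n` is the outward unit normal at `x` to the boundary of `Ω`: it is a unit vector, it is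
orthogonal to the boundary at `x`, and it points from `Ω` to the exterior. -/
def IsOutwardUnitNormal (Ω : Set E3) (x n : E3) : Prop :=
  ‖n‖ = 1 ∧
  (fun y : E3 => inner ℝ n (y - x)) =o[𝓝[frontier Ω] x] (fun y : E3 => y - x) ∧
  ∀ᶠ t : ℝ in 𝓝[>] 0, x + t • n ∉ closure Ω ∧ x - t • n ∈ Ω

namespace HolderDomain

variable {α : ℝ≥0} (D : HolderDomain α)

/-- The surface `Γ = ∂Ω`, with the metric of `ℝ³`. -/
abbrev Γ : Type := ↥(frontier D.carrier)

instance : CompactSpace D.Γ :=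
  isCompact_iff_compactSpace.mp
    (Metric.isCompact_of_isClosed_isBounded isClosed_frontier
      (D.isBounded.closure.subset frontier_subset_closure))

theorem mem_frontier_of_graph {e : E3 ≃ᵃⁱ[ℝ] WithLp 2 (E2 × ℝ)} {f : E2 → ℝ} {W : Set E3}
    (hf : Continuous f) (hW : IsOpen W)
    (h : ∀ y ∈ W, (y ∈ D.carrier ↔ (e y).snd < f (e y).fst)) {y : E3} (hy : y ∈ W) :
    (y ∈ frontier D.carrier ↔ (e y).snd = f (e y).fst) ∧
      (y ∈ closure D.carrier → (e y).snd ≤ f (e y).fst) := by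
  have hle : y ∈ closure D.carrier → (e y).snd ≤ f (e y).fst := by
    intro hc
    by_contra hlt
    push Not at hlt
    have ho : IsOpen (W ∩ {z | f (e z).fst < (e z).snd}) := by
      refine hW.inter (isOpen_lt ?_ ?_)
      · exact hf.comp ((WithLp.prod_continuous_ofLp 2 E2 ℝ).comp e.continuous).fst
      · exact ((WithLp.prod_continuous_ofLp 2 E2 ℝ).comp e.continuous).snd
    obtain ⟨z, ⟨hzW, hz⟩, hzD⟩ := mem_closure_iff.mp hc _ ho ⟨hy, hlt⟩
    exact lt_asymm ((h z hzW).mp hzD) hz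
  refine ⟨?_, hle⟩
  rw [D.isOpen.frontier_eq]
  constructor
  · rintro ⟨hc, hn⟩
    rw [h y hy] at hn
    exact le_antisymm (hle hc) (not_lt.mp hn)
  · intro heq
    refine ⟨?_, fun hn => ?_⟩
    · let A := e.linearIsometryEquiv
      let c : ℝ → E3 := fun t => A.symm (WithLp.toLp 2 (0, -t)) +ᵥ y
      have hec : ∀ t, e (c t) = WithLp.toLp 2 (0, -t) + e y := fun t => by
        have := e.map_vadd y (A.symm (WithLp.toLp 2 (0, -t)))
        rw [LinearIsometryEquiv.apply_symm_apply] at this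
        exact this
      have hcc : Continuous c := by
        have : Continuous fun t : ℝ => WithLp.toLp 2 ((0 : E2), -t) :=
          (WithLp.prod_continuous_toLp 2 E2 ℝ).comp (by fun_prop)
        exact (A.symm.continuous.comp this).add continuous_const
      have hc0 : c 0 = y := by simp [c]
      refine mem_closure_of_tendsto (f := c) (b := 𝓝[>] (0 : ℝ)) ?_ ?_
      · have := hcc.tendsto 0
        rw [hc0] at this
        exact this.mono_left nhdsWithin_le_nhds
      · have hW' : ∀ᶠ t in 𝓝[>] (0 : ℝ), c t ∈ W := by
          refine nhdsWithin_le_nhds (hcc.continuousAt.preimage_mem_nhds ?_)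
          rw [hc0]
          exact hW.mem_nhds hy
        filter_upwards [hW', self_mem_nhdsWithin] with t ht ht0
        rw [h _ ht, hec]
        have : (0 : ℝ) < t := ht0
        simp [heq, this]
    · rw [h y hy, heq] at hn
      exact lt_irrefl _ hn

theorem exists_curve (x : D.Γ) : ∃ (A : E3 ≃ₗᵢ[ℝ] WithLp 2 (E2 × ℝ)) (T : E2 →L[ℝ] ℝ),
    (∃ n, IsOutwardUnitNormal D.carrier x n) ∧
    ∀ w : E2, ∃ c : ℝ → E3, c 0 = x ∧ (∀ᶠ t in 𝓝 (0 : ℝ), c t ∈ frontier D.carrier) ∧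
      HasDerivAt c (A.symm (WithLp.toLp 2 (w, T w))) 0 := by
  obtain ⟨e, f, W, hf2, -, hW, hxW, h⟩ := D.local_graph x x.2
  have hf : Continuous f := hf2.continuous
  let A := e.linearIsometryEquiv
  set a : E2 := (e x).fst with ha
  have hfd : HasFDerivAt f (fderiv ℝ f a) a :=
    (hf2.differentiable (by norm_num)).differentiableAt.hasFDerivAt
  have hxf : (e x).snd = f a := (D.mem_frontier_of_graph hf hW h hxW).1.mp x.2
  have heA : ∀ v : E3, e (v +ᵥ (x : E3)) = A v + e x := fun v =>
    e.map_vadd (x : E3) v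
  refine ⟨A, fderiv ℝ f a, ?_, ?_⟩
  · obtain ⟨G, hG⟩ : ∃ G : E2, ∀ w, fderiv ℝ f a w = inner ℝ G w :=
      ⟨(InnerProductSpace.toDual ℝ E2).symm (fderiv ℝ f a), fun w => by simp⟩
    let m : E3 := A.symm (WithLp.toLp 2 (-G, 1))
    have hAm : A m = WithLp.toLp 2 (-G, 1) := by simp [m]
    have hm0 : m ≠ 0 := by
      intro h0
      rw [h0, map_zero] at hAm
      have := congrArg WithLp.snd hAm
      simp at this
    have hmpos : 0 < ‖m‖ := norm_pos_iff.mpr hm0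
    -- the height of `x + t m` above the graph
    let d : ℝ → ℝ := fun t => (f a + t) - f (a - t • G)
    have hd : HasDerivAt d (1 + ‖G‖ ^ 2) 0 := by
      have h1 : HasDerivAt (fun t : ℝ => a - t • G) (-G) 0 := by
        simpa using ((hasDerivAt_id (0 : ℝ)).smul_const G).const_sub a
      have h2 : HasDerivAt (fun t : ℝ => f (a - t • G)) (fderiv ℝ f a (-G)) 0 := by
        refine HasFDerivAt.comp_hasDerivAt (0 : ℝ) ?_ h1
        simpa using hfd
      have h3 := ((hasDerivAt_id (0 : ℝ)).const_add (f a)).sub h2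
      have e1 : (1 : ℝ) - fderiv ℝ f a (-G) = 1 + ‖G‖ ^ 2 := by
        rw [hG, inner_neg_right, real_inner_self_eq_norm_sq]; ring
      rw [e1] at h3
      exact h3
    have hd0 : d 0 = 0 := by simp [d]
    have hslope : ∀ᶠ t in 𝓝[≠] (0 : ℝ), 0 < slope d 0 t :=
      (hasDerivAt_iff_tendsto_slope.mp hd).eventually (lt_mem_nhds (by positivity))
    have hcurve : ∀ t : ℝ, e ((x : E3) + t • m) = WithLp.toLp 2 (a - t • G, f a + t) := by
      intro t
      have : (x : E3) + t • m = (t • m) +ᵥ (x : E3) := by simp [add_comm]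
      rw [this, heA, map_smul, hAm]
      refine WithLp.ofLp_injective 2 (Prod.ext ?_ ?_)
      · simp [← ha]; abel
      · simp [hxf, add_comm]
    have hWm : ∀ᶠ t in 𝓝 (0 : ℝ), (x : E3) + t • m ∈ W := by
      have : Continuous fun t : ℝ => (x : E3) + t • m := by fun_prop
      refine this.continuousAt.preimage_mem_nhds ?_
      simpa using hW.mem_nhds hxW
    have hout : ∀ᶠ t in 𝓝[>] (0 : ℝ), (x : E3) + t • m ∉ closure D.carrier := by
      have h1 : ∀ᶠ t in 𝓝[>] (0 : ℝ), 0 < slope d 0 t :=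
        hslope.filter_mono (nhdsWithin_mono _ (fun t (ht : (0 : ℝ) < t) => ht.ne'))
      filter_upwards [h1, nhdsWithin_le_nhds hWm, self_mem_nhdsWithin] with t ht htW ht0 hc
      have ht0 : (0 : ℝ) < t := ht0
      have h2 := (D.mem_frontier_of_graph hf hW h htW).2 hc
      rw [hcurve] at h2
      have h3 : d t ≤ 0 := by simpa [d] using h2
      rw [slope_def_field, hd0, sub_zero, sub_zero] at ht
      have := (div_pos_iff_of_pos_right ht0).mp ht
      linarith
    have hin : ∀ᶠ t in 𝓝[<] (0 : ℝ), (x : E3) + t • m ∈ D.carrier := by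
      have h1 : ∀ᶠ t in 𝓝[<] (0 : ℝ), 0 < slope d 0 t :=
        hslope.filter_mono (nhdsWithin_mono _ (fun t (ht : t < (0 : ℝ)) => ht.ne))
      filter_upwards [h1, nhdsWithin_le_nhds hWm, self_mem_nhdsWithin] with t ht htW ht0
      have ht0 : t < (0 : ℝ) := ht0
      rw [h _ htW, hcurve]
      rw [slope_def_field, hd0, sub_zero, sub_zero] at ht
      have h3 : d t < 0 := by
        by_contra h4
        push Not at h4
        exact absurd ht (not_lt.mpr (div_nonpos_of_nonneg_of_nonpos h4 ht0.le))
      have h5 : f a + t - f (a - t • G) < 0 := h3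
      have h6 : f a + t < f (a - t • G) := by linarith
      exact h6
    refine ⟨‖m‖⁻¹ • m, ?_, ?_, ?_⟩
    · rw [norm_smul, norm_inv, norm_norm, inv_mul_cancel₀ hmpos.ne']
    · have hm : (fun y : E3 => inner ℝ m (y - x)) =o[𝓝[frontier D.carrier] (x : E3)]
          (fun y : E3 => y - x) := by
        have ht : Tendsto (fun y : E3 => (e y).fst) (𝓝[frontier D.carrier] (x : E3)) (𝓝 a) :=
          ((((WithLp.prod_continuous_ofLp 2 E2 ℝ).comp e.continuous).fst).tendsto
            (x : E3)).mono_left nhdsWithin_le_nhds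
        have h1 := hfd.isLittleO.comp_tendsto ht
        have h2 : (fun y : E3 => (e y).fst - a) =O[𝓝[frontier D.carrier] (x : E3)]
            (fun y : E3 => y - x) := by
          refine IsBigO.of_bound 1 (Eventually.of_forall fun y => ?_)
          have h3 : ‖e y - e x‖ = ‖y - x‖ := by
            rw [← dist_eq_norm, ← dist_eq_norm, e.dist_map]
          rw [one_mul, ← h3]
          have := WithLp.prod_norm_sq_eq_of_L2 (e y - e x)
          have h4 : ‖(e y).fst - a‖ = ‖(e y - e x).fst‖ := by simp [ha]
          rw [h4]
          refine (sq_le_sq₀ (norm_nonneg _) (norm_nonneg _)).mp ?_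
          nlinarith [sq_nonneg ‖(e y - e x).snd‖]
        refine (h1.trans_isBigO h2).congr' ?_ EventuallyEq.rfl
        filter_upwards [self_mem_nhdsWithin, nhdsWithin_le_nhds (hW.mem_nhds hxW)] with y hy hyW
        have hyf := (D.mem_frontier_of_graph hf hW h hyW).1.mp hy
        have h5 : A (y - x) = e y - e x := by
          have := e.map_vsub y (x : E3)
          simpa [A] using this
        have h6 : inner ℝ m (y - x) = inner ℝ (A m) (A (y - x)) := (A.inner_map_map _ _).symm
        rw [h6, hAm, h5, WithLp.prod_inner_apply]
        simp only [Function.comp_apply, WithLp.ofLp_sub, Prod.fst_sub, Prod.snd_sub]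
        have h7 : inner ℝ (1 : ℝ) ((e y).snd - (e x).snd) = (e y).snd - (e x).snd := by simp
        have h8 : inner ℝ (-G) ((e y).fst - a) = - fderiv ℝ f a ((e y).fst - a) := by
          rw [hG, inner_neg_left]
        change _ = inner ℝ (-G) ((e y).fst - a) + inner ℝ (1 : ℝ) ((e y).snd - (e x).snd)
        rw [h7, h8, hyf, hxf]
        ring
      refine (hm.const_mul_left ‖m‖⁻¹).congr_left fun y => ?_
      rw [real_inner_smul_left]
    · have hpos : 0 < ‖m‖⁻¹ := inv_pos.mpr hmpos
      have hs1 : Tendsto (fun t : ℝ => t * ‖m‖⁻¹) (𝓝[>] 0) (𝓝[>] 0) := by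
        refine tendsto_nhdsWithin_iff.mpr ⟨?_, ?_⟩
        · have : Continuous fun t : ℝ => t * ‖m‖⁻¹ := by fun_prop
          simpa using (this.tendsto 0).mono_left nhdsWithin_le_nhds
        · filter_upwards [self_mem_nhdsWithin] with t ht
          exact mul_pos ht hpos
      have hs2 : Tendsto (fun t : ℝ => -(t * ‖m‖⁻¹)) (𝓝[>] 0) (𝓝[<] 0) := by
        refine tendsto_nhdsWithin_iff.mpr ⟨?_, ?_⟩
        · have : Continuous fun t : ℝ => -(t * ‖m‖⁻¹) := by fun_prop
          simpa using (this.tendsto 0).mono_left nhdsWithin_le_nhds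
        · filter_upwards [self_mem_nhdsWithin] with t ht
          exact neg_neg_of_pos (mul_pos ht hpos)
      filter_upwards [hs1.eventually hout, hs2.eventually hin] with t h1 h2
      rw [smul_smul]
      exact ⟨h1, by rwa [neg_smul, ← sub_eq_add_neg] at h2⟩
  · intro w
    refine ⟨fun t => (x : E3) + A.symm (WithLp.toLp 2 (t • w, f (a + t • w) - f a)), ?_, ?_, ?_⟩
    · have : WithLp.toLp 2 ((0 : ℝ) • w, f (a + (0 : ℝ) • w) - f a) = 0 := by simp
      simp only [this, map_zero, add_zero]
    · have hcont : Continuous fun t : ℝ =>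
          (x : E3) + A.symm (WithLp.toLp 2 (t • w, f (a + t • w) - f a)) := by
        have : Continuous fun t : ℝ => WithLp.toLp 2 (t • w, f (a + t • w) - f a) :=
          (WithLp.prod_continuous_toLp 2 E2 ℝ).comp (by fun_prop)
        exact continuous_const.add (A.symm.continuous.comp this)
      have hW' : ∀ᶠ t in 𝓝 (0 : ℝ),
          (x : E3) + A.symm (WithLp.toLp 2 (t • w, f (a + t • w) - f a)) ∈ W := by
        refine hcont.continuousAt.preimage_mem_nhds ?_
        have h0 : (x : E3) + A.symm (WithLp.toLp 2 ((0 : ℝ) • w, f (a + (0 : ℝ) • w) - f a)) = x := by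
          have : WithLp.toLp 2 ((0 : ℝ) • w, f (a + (0 : ℝ) • w) - f a) = 0 := by simp
          rw [this, map_zero, add_zero]
        rw [h0]
        exact hW.mem_nhds hxW
      filter_upwards [hW'] with t ht
      rw [(D.mem_frontier_of_graph hf hW h ht).1]
      have : (x : E3) + A.symm (WithLp.toLp 2 (t • w, f (a + t • w) - f a)) =
          A.symm (WithLp.toLp 2 (t • w, f (a + t • w) - f a)) +ᵥ (x : E3) := by simp [add_comm]
      rw [this, heA]
      simp [hxf, ← ha, add_comm]
    · have h1 : HasDerivAt (fun t : ℝ => a + t • w) w 0 := by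
        simpa using ((hasDerivAt_id (0 : ℝ)).smul_const w).const_add a
      have h2 : HasDerivAt (fun t : ℝ => f (a + t • w)) (fderiv ℝ f a w) 0 := by
        refine HasFDerivAt.comp_hasDerivAt (0 : ℝ) ?_ h1
        simpa using hfd
      have h3 : HasDerivAt (fun t : ℝ => t • w) w 0 := by
        simpa using (hasDerivAt_id (0 : ℝ)).smul_const w
      have h4 : HasDerivAt (fun t : ℝ => (t • w, f (a + t • w) - f a)) (w, fderiv ℝ f a w) 0 :=
        h3.prodMk (h2.sub_const _)
      let B : (E2 × ℝ) →L[ℝ] E3 :=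
        (A.symm.toContinuousLinearEquiv : WithLp 2 (E2 × ℝ) →L[ℝ] E3).comp
          ((WithLp.prodContinuousLinearEquiv 2 ℝ E2 ℝ).symm : (E2 × ℝ) →L[ℝ] WithLp 2 (E2 × ℝ))
      exact (B.hasFDerivAt.comp_hasDerivAt (0 : ℝ) h4).const_add (x : E3)

theorem exists_isOutwardUnitNormal (x : D.Γ) : ∃ n, IsOutwardUnitNormal D.carrier x n := by
  obtain ⟨_, _, h, _⟩ := D.exists_curve x
  exact h

/-- A real-linear map that is `o(|y - x|)` along the surface vanishes along curves. -/
theorem eq_zero_of_isLittleO {x : D.Γ} {V : Type} [NormedAddCommGroup V] [NormedSpace ℝ V]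
    {L : E3 →L[ℝ] V}
    (hL : (fun y : E3 => L (y - x)) =o[𝓝[frontier D.carrier] (x : E3)] (fun y : E3 => y - x))
    {c : ℝ → E3} {v : E3} (hc0 : c 0 = x) (hc : ∀ᶠ t in 𝓝 (0 : ℝ), c t ∈ frontier D.carrier)
    (hv : HasDerivAt c v 0) : L v = 0 := by
  have ht : Tendsto c (𝓝 0) (𝓝[frontier D.carrier] (x : E3)) := by
    refine tendsto_nhdsWithin_iff.mpr ⟨?_, hc⟩
    have := hv.continuousAt.tendsto
    rwa [hc0] at this
  have h1 := hL.comp_tendsto ht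
  have h2 : (fun t : ℝ => c t - x) =O[𝓝 0] (fun t : ℝ => t) := by
    have := hv.isBigO_sub
    simpa [hc0] using this
  have h3 : (fun t : ℝ => L (c t - x)) =o[𝓝 0] (fun t : ℝ => t) := h1.trans_isBigO h2
  have h4 : HasDerivAt (fun t : ℝ => L (c t - x)) 0 0 := by
    rw [hasDerivAt_iff_isLittleO]
    simpa [hc0] using h3
  have h5 : HasDerivAt (fun t : ℝ => L (c t - x)) (L v) 0 :=
    L.hasFDerivAt.comp_hasDerivAt (0 : ℝ) (hv.sub_const (x : E3))
  exact h5.unique h4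

/-- A real-linear map that is `o(|y - x|)` along the surface and vanishes on a normal vanishes. -/
theorem eq_zero_of_normal {x : D.Γ} {V : Type} [NormedAddCommGroup V] [NormedSpace ℝ V]
    {L : E3 →L[ℝ] V}
    (hL : (fun y : E3 => L (y - x)) =o[𝓝[frontier D.carrier] (x : E3)] (fun y : E3 => y - x))
    {n : E3} (hn : IsOutwardUnitNormal D.carrier x n) (hLn : L n = 0) : L = 0 := by
  obtain ⟨A, T, -, hcurve⟩ := D.exists_curve x
  have htan : ∀ w : E2, L (A.symm (WithLp.toLp 2 (w, T w))) = 0 := fun w => by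
    obtain ⟨c, h0, h1, h2⟩ := hcurve w
    exact D.eq_zero_of_isLittleO hL h0 h1 h2
  have hntan : ∀ w : E2, inner ℝ n (A.symm (WithLp.toLp 2 (w, T w))) = 0 := fun w => by
    obtain ⟨c, h0, h1, h2⟩ := hcurve w
    exact D.eq_zero_of_isLittleO (L := innerSL ℝ n) hn.2.1 h0 h1 h2
  have hdec : ∀ v : E3, v = A.symm (WithLp.toLp 2 ((A v).fst, T (A v).fst)) +
      ((A v).snd - T (A v).fst) • A.symm (WithLp.toLp 2 ((0 : E2), (1 : ℝ))) := fun v => by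
    apply A.injective
    rw [map_add, map_smul, A.apply_symm_apply, A.apply_symm_apply]
    refine WithLp.ofLp_injective 2 (Prod.ext ?_ ?_) <;> simp
  have hv0 : L (A.symm (WithLp.toLp 2 ((0 : E2), (1 : ℝ)))) = 0 := by
    have h1 := hLn
    rw [hdec n, map_add, htan, zero_add, map_smul] at h1
    rcases smul_eq_zero.mp h1 with h2 | h2
    · exfalso
      have h3 := hdec n
      rw [h2, zero_smul, add_zero] at h3
      have h4 := hntan (A n).fst
      rw [← h3, real_inner_self_eq_norm_sq, hn.1] at h4
      norm_num at h4
    · exact h2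
  ext v
  rw [hdec v, map_add, htan, zero_add, map_smul, hv0, smul_zero]
  rfl

/-- The outward unit normal `ν` on `Γ`. -/
noncomputable def normal (x : D.Γ) : E3 := (D.exists_isOutwardUnitNormal x).choose

theorem normal_spec (x : D.Γ) : IsOutwardUnitNormal D.carrier x (D.normal x) :=
  (D.exists_isOutwardUnitNormal x).choose_spec

theorem normal_unique (x : D.Γ) {n : E3} (hn : IsOutwardUnitNormal D.carrier x n) :
    n = D.normal x := by
  have hm := D.normal_spec x
  set m := D.normal x with hmdef
  let L : E3 →L[ℝ] ℝ := innerSL ℝ (n - (inner ℝ n m : ℝ) • m)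
  have hLv : ∀ v, L v = inner ℝ n v - inner ℝ n m * inner ℝ m v := fun v => by
    change inner ℝ (n - (inner ℝ n m : ℝ) • m) v = _
    rw [inner_sub_left, real_inner_smul_left]
  have hL : L = 0 := by
    refine D.eq_zero_of_normal (x := x) ?_ hm ?_
    · refine (hn.2.1.sub (hm.2.1.const_mul_left (inner ℝ n m))).congr_left fun y => ?_
      rw [hLv]
    · rw [hLv, real_inner_self_eq_norm_sq, hm.1]
      ring
  have hnm : n = (inner ℝ n m : ℝ) • m := by
    have h1 : L (n - (inner ℝ n m : ℝ) • m) = 0 := by rw [hL]; rfl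
    have h2 : inner ℝ (n - (inner ℝ n m : ℝ) • m) (n - (inner ℝ n m : ℝ) • m) = (0 : ℝ) := h1
    exact sub_eq_zero.mp (inner_self_eq_zero.mp h2)
  have habs : |(inner ℝ n m : ℝ)| = 1 := by
    have h1 := congrArg norm hnm
    rw [norm_smul, hn.1, hm.1, mul_one, Real.norm_eq_abs] at h1
    exact h1.symm
  rcases (abs_eq zero_le_one).mp habs with h1 | h1
  · rw [h1, one_smul] at hnm
    exact hnm
  · exfalso
    rw [h1, neg_one_smul] at hnm
    obtain ⟨t, h2, h3⟩ := (hn.2.2.and hm.2.2).exists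
    refine h2.1 (subset_closure ?_)
    rw [hnm, smul_neg, ← sub_eq_add_neg]
    exact h3.2

/-- `g` is the surface gradient at `x` of the function `f` on `Γ`: it is tangential, and
`f(y) = f(x) + g · (y - x) + o(|y - x|)` as `y → x` on `Γ`. -/
def HasSurfaceGradientAt (f : D.Γ → ℂ) (g : Fin 3 → ℂ) (x : D.Γ) : Prop :=
  cdot (D.normal x) g = 0 ∧
  (fun y : D.Γ => f y - f x - cdot ((y : E3) - x) g) =o[𝓝 x] (fun y : D.Γ => (y : E3) - x)

theorem HasSurfaceGradientAt.unique {D : HolderDomain α} {f : D.Γ → ℂ} {g g' : Fin 3 → ℂ} {x : D.Γ}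
    (h : D.HasSurfaceGradientAt f g x) (h' : D.HasSurfaceGradientAt f g' x) : g = g' := by
  let L : E3 →L[ℝ] ℂ := LinearMap.toContinuousLinearMap
    { toFun := fun v => cdot v (g - g')
      map_add' := fun v w => cdot_add_left v w _
      map_smul' := fun c v => by simpa using cdot_smul_left c v (g - g') }
  have hLv : ∀ v, L v = cdot v g - cdot v g' := fun v => cdot_sub_right v g g'
  have hL : L = 0 := by
    refine D.eq_zero_of_normal (x := x) ?_ (D.normal_spec x) ?_
    · have h1 : (fun y : D.Γ => L ((y : E3) - x)) =o[𝓝 x] (fun y : D.Γ => (y : E3) - x) := by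
        refine (h'.2.sub h.2).congr_left fun y => ?_
        rw [hLv]
        ring
      rw [nhdsWithin_eq_map_subtype_coe x.2, isLittleO_map]
      exact h1
    · rw [hLv, h.1, h'.1, sub_zero]
  funext i
  have h1 : L (EuclideanSpace.single i 1) = 0 := by rw [hL]; rfl
  rw [hLv] at h1
  have h2 : ∀ k : Fin 3 → ℂ, cdot (EuclideanSpace.single i (1 : ℝ)) k = k i := fun k => by
    rw [cdot, Finset.sum_eq_single i]
    · simp
    · intro j _ hj
      simp [hj]
    · simp
  rw [h2, h2] at h1
  exact sub_eq_zero.mp h1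

/-- The pairs `(f, ∇_Γ f)` of a function `f` on `Γ` and its surface gradient, where the latter
exists everywhere and lies in `C^{0,α}(Γ, ℂ³)`. The norm of the ambient space is
`‖(f, g)‖ = ‖f‖_{C(Γ)} + ‖g‖_{C^{0,α}(Γ, ℂ³)}`. -/
noncomputable def holderC1Submodule : Submodule ℂ (WithLp 1 (C(D.Γ, ℂ) × HolderC0Vec D.Γ α)) where
  carrier := {p | ∀ x, D.HasSurfaceGradientAt p.fst (HolderC0Vec.toFun p.snd x) x}
  add_mem' := fun {p q} hp hq x => by
    refine ⟨?_, ((hp x).2.add (hq x).2).congr_left fun y => ?_⟩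
    · have h := cdot_add_right (D.normal x) (HolderC0Vec.toFun p.snd x) (HolderC0Vec.toFun q.snd x)
      rw [(hp x).1, (hq x).1, add_zero] at h
      exact h
    · have h := cdot_add_right ((y : E3) - x) (HolderC0Vec.toFun p.snd x)
        (HolderC0Vec.toFun q.snd x)
      change _ = (p.fst y + q.fst y) - (p.fst x + q.fst x) - cdot ((y : E3) - x)
        (HolderC0Vec.toFun p.snd x + HolderC0Vec.toFun q.snd x)
      rw [h]
      ring
  zero_mem' := fun x => by
    have h0 : HolderC0Vec.toFun (0 : HolderC0Vec D.Γ α) x = 0 := rfl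
    refine ⟨?_, (isLittleO_zero _ _).congr_left fun y => ?_⟩
    · change cdot _ (HolderC0Vec.toFun (0 : HolderC0Vec D.Γ α) x) = 0
      rw [h0]
      simp [cdot]
    · change (0 : ℂ) = 0 - 0 - cdot _ (HolderC0Vec.toFun (0 : HolderC0Vec D.Γ α) x)
      rw [h0]
      simp [cdot]
  smul_mem' := fun c p hp x => by
    refine ⟨?_, ((hp x).2.const_mul_left c).congr_left fun y => ?_⟩
    · have h := cdot_smul_right (D.normal x) c (HolderC0Vec.toFun p.snd x)
      rw [(hp x).1, mul_zero] at h
      exact h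
    · have h := cdot_smul_right ((y : E3) - x) c (HolderC0Vec.toFun p.snd x)
      change _ = c * p.fst y - c * p.fst x - cdot ((y : E3) - x)
        (c • HolderC0Vec.toFun p.snd x)
      rw [h]
      ring

/-- The space `C^{1,α}(Γ)` of the functions `f` on `Γ` whose surface gradient `∇_Γ f` exists
everywhere and lies in `C^{0,α}(Γ, ℂ³)`, with norm `‖f‖_{C(Γ)} + ‖∇_Γ f‖_{C^{0,α}(Γ, ℂ³)}`.
It is realized as the set of the pairs `(f, ∇_Γ f)`; as the surface gradient is unique, such a
pair is determined by `f` (`HolderC1.ext`). -/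
def HolderC1 : Type := D.holderC1Submodule

namespace HolderC1

noncomputable instance : NormedAddCommGroup D.HolderC1 :=
  inferInstanceAs (NormedAddCommGroup D.holderC1Submodule)

noncomputable instance : NormedSpace ℂ D.HolderC1 :=
  inferInstanceAs (NormedSpace ℂ D.holderC1Submodule)

variable {D}

/-- The underlying continuous function. -/
noncomputable def toCont (f : D.HolderC1) : C(D.Γ, ℂ) := f.1.fst

/-- The surface gradient. -/
noncomputable def grad (f : D.HolderC1) : HolderC0Vec D.Γ α := f.1.snd

noncomputable instance : CoeFun D.HolderC1 (fun _ => D.Γ → ℂ) := ⟨fun f => f.toCont⟩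

theorem hasSurfaceGradientAt (f : D.HolderC1) (x : D.Γ) :
    D.HasSurfaceGradientAt f (f.grad.toFun x) x := f.2 x

theorem norm_def (f : D.HolderC1) : ‖f‖ = ‖f.toCont‖ + ‖f.grad‖ :=
  WithLp.prod_norm_eq_of_L1 f.1

theorem ext {f g : D.HolderC1} (h : ∀ x, f x = g x) : f = g := by
  have h1 : f.toCont = g.toCont := ContinuousMap.ext h
  have h2 : f.grad = g.grad := by
    ext i
    refine Subtype.ext (ContinuousMap.ext fun x => ?_)
    have hg := g.hasSurfaceGradientAt x
    rw [← h1] at hg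
    exact congrFun ((f.hasSurfaceGradientAt x).unique hg) i
  exact Subtype.ext (WithLp.ofLp_injective 1 (Prod.ext h1 h2))

end HolderC1

/-- The space `C^{1,α}(Γ, ℂ³)`, with norm `∑ᵢ ‖fᵢ‖_{C^{1,α}(Γ)}`. -/
abbrev HolderC1Vec : Type := PiLp 1 (fun _ : Fin 3 => D.HolderC1)

variable {D} in
/-- The `ℂ³`-valued function on `Γ` given by an element of `C^{1,α}(Γ, ℂ³)`. -/
noncomputable def HolderC1Vec.toFun (φ : D.HolderC1Vec) : D.Γ → Fin 3 → ℂ :=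
  fun x i => φ i x

/-- The surface measure `ds` on `Γ`: the two-dimensional Hausdorff measure, normalized so that
it is Lebesgue measure on the plane. -/
noncomputable def surfaceMeasure : Measure D.Γ := μHE[2]

/-- The fundamental solution `1 / (4π|x - y|)` of the Laplace equation. -/
noncomputable def laplaceKernel (x y : D.Γ) : ℂ := ((1 / (4 * Real.pi * ‖(x : E3) - y‖) : ℝ) : ℂ)

/-- The scalar Laplace single-layer operator `S₀`. -/
noncomputable def singleLayer (u : D.Γ → ℂ) (x : D.Γ) : ℂ :=
  ∫ y, D.laplaceKernel x y * u y ∂D.surfaceMeasure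

/-- The vector Laplace single-layer operator, acting componentwise. -/
noncomputable def vecSingleLayer (φ : D.Γ → Fin 3 → ℂ) (x : D.Γ) : Fin 3 → ℂ :=
  fun i => D.singleLayer (fun y => φ y i) x

/-- The function `ν · φ`. -/
noncomputable def normalDot (φ : D.Γ → Fin 3 → ℂ) (x : D.Γ) : ℂ := cdot (D.normal x) (φ x)

/-- The normal projector `P_ν φ = (ν · φ) ν`. -/
noncomputable def projNormal (φ : D.Γ → Fin 3 → ℂ) (x : D.Γ) : Fin 3 → ℂ :=
  D.normalDot φ x • toC3 (D.normal x)

/-- The tangential projector `P_t φ = φ - (ν · φ) ν`. -/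
noncomputable def projTangential (φ : D.Γ → Fin 3 → ℂ) (x : D.Γ) : Fin 3 → ℂ :=
  φ x - D.projNormal φ x

/-- The commutator `C_ν φ = ν S₀(ν · φ) - S₀ P_ν φ`. -/
noncomputable def commNormal (φ : D.Γ → Fin 3 → ℂ) (x : D.Γ) : Fin 3 → ℂ :=
  D.singleLayer (D.normalDot φ) x • toC3 (D.normal x) - D.vecSingleLayer (D.projNormal φ) x

/-- The commutator `C_t φ = P_t S₀ φ - S₀ P_t φ`. -/
noncomputable def commTangential (φ : D.Γ → Fin 3 → ℂ) (x : D.Γ) : Fin 3 → ℂ :=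
  D.projTangential (D.vecSingleLayer φ) x - D.vecSingleLayer (D.projTangential φ) x

/-- The integrand of the integral representation of `C_ν`. -/
noncomputable def commNormalIntegrand (φ : D.Γ → Fin 3 → ℂ) (x y : D.Γ) : Fin 3 → ℂ :=
  (cdot (D.normal y) (φ y) * D.laplaceKernel x y) • (toC3 (D.normal x) - toC3 (D.normal y))

/-- The integrand of the integral representation of `C_t`. -/
noncomputable def commTangentialIntegrand (φ : D.Γ → Fin 3 → ℂ) (x y : D.Γ) : Fin 3 → ℂ :=
  D.laplaceKernel x y • (cdot (D.normal x) (φ y) • toC3 (D.normal x) -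
    cdot (D.normal y) (φ y) • toC3 (D.normal y))

end HolderDomain

/-!
Componentwise, `C_ν` and `C_t` are sums of commutators `[p, S₀] ψ = p S₀ ψ - S₀ (p ψ)`, where `p` is
`ν_i` or `ν_i ν_j`. Such a commutator has the bounded kernel `(p x - p y) / (4 π |x - y|)`. Its
gradient in `x` is the `C^{0,α}` function `∇p(x)` times `|x - y|⁻¹`, up to a multiple, plus a kernel
with the same singularity as `|x - y|⁻¹`: size `O(|x - y|⁻¹)` and variation in `x` of size
`O(|x - x'| |x - y|⁻²)`. As `Γ` is two-dimensional, such kernels define bounded operators from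
`C(Γ)` to `C^{0,α}(Γ)` for every `α < 1`. Hence `[p, S₀]` is bounded from `C(Γ)` to `C^{1,α}(Γ)`,
and it is compact on `C^{0,α}(Γ)` because the embedding of `C^{0,α}(Γ)` into `C(Γ)` is compact by
the Arzelà–Ascoli theorem.
-/

/-- `f` is Hölder continuous with exponent `r` on some neighbourhood of `p`. -/
def LocHolderAt {X Y : Type*} [PseudoMetricSpace X] [PseudoMetricSpace Y] (r : ℝ≥0) (f : X → Y)
    (p : X) : Prop :=
  ∃ C : ℝ≥0, ∃ U ∈ 𝓝 p, HolderOnWith C r f U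

namespace LocHolderAt

section Metric

variable {X Y Z : Type*} [PseudoMetricSpace X] [PseudoMetricSpace Y] [PseudoMetricSpace Z]
  {r s : ℝ≥0} {f g : X → Y} {p : X}

theorem congr (hf : LocHolderAt r f p) (h : f =ᶠ[𝓝 p] g) : LocHolderAt r g p := by
  obtain ⟨C, U, hU, hC⟩ := hf
  refine ⟨C, U ∩ {x | f x = g x}, inter_mem hU h, ?_⟩
  rintro x ⟨hx, hfx⟩ y ⟨hy, hfy⟩
  exact hfx ▸ hfy ▸ hC x hx y hy

theorem of_memHolder (hf : MemHolder r f) : LocHolderAt r f p :=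
  let ⟨C, hC⟩ := hf
  ⟨C, Set.univ, univ_mem, hC.holderOnWith _⟩

theorem of_lipschitzWith {K : ℝ≥0} (hf : LipschitzWith K f) : LocHolderAt 1 f p :=
  of_memHolder ⟨K, holderWith_one.mpr hf⟩

theorem of_le (hf : LocHolderAt r f p) (hsr : s ≤ r) : LocHolderAt s f p := by
  obtain ⟨C, U, hU, hC⟩ := hf
  obtain ⟨C', hC'⟩ := HolderOnWith.exists_holderOnWith_of_le
    ⟨C, hC.mono Set.inter_subset_left⟩ hsr
    ((Metric.isBounded_ball (x := p) (r := 1)).subset Set.inter_subset_right)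
  exact ⟨C', _, inter_mem hU (Metric.ball_mem_nhds p one_pos), hC'⟩

theorem continuousAt (hf : LocHolderAt r f p) (hr : 0 < r) : ContinuousAt f p :=
  let ⟨_, _, hU, hC⟩ := hf
  (hC.continuousOn hr).continuousAt hU

theorem comp {g : Y → Z} (hg : LocHolderAt s g (f p)) (hf : LocHolderAt r f p)
    (hcont : ContinuousAt f p) : LocHolderAt (s * r) (g ∘ f) p := by
  obtain ⟨C, U, hU, hC⟩ := hf
  obtain ⟨C', V, hV, hC'⟩ := hg
  exact ⟨_, U ∩ f ⁻¹' V, inter_mem hU (hcont hV),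
    hC'.comp (hC.mono Set.inter_subset_left) fun _ hx => hx.2⟩

theorem prodMk {g : X → Z} (hf : LocHolderAt r f p) (hg : LocHolderAt r g p) :
    LocHolderAt r (fun x => (f x, g x)) p := by
  obtain ⟨C, U, hU, hC⟩ := hf
  obtain ⟨C', V, hV, hC'⟩ := hg
  refine ⟨max C C', U ∩ V, inter_mem hU hV, fun x hx y hy => max_le ?_ ?_⟩
  · exact (hC x hx.1 y hy.1).trans (by gcongr; exact le_max_left _ _)
  · exact (hC' x hx.2 y hy.2).trans (by gcongr; exact le_max_right _ _)

end Metric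

theorem exists_eventually_edist_le {X Y : Type*} [MetricSpace X] [PseudoMetricSpace Y] {r : ℝ≥0}
    (hr : 0 < r) {f : X → Y} (hf : ∀ p, LocHolderAt r f p) (p q : X) :
    ∃ C : ℝ≥0, ∀ᶠ z : X × X in 𝓝 (p, q),
      edist (f z.1) (f z.2) ≤ C * edist z.1 z.2 ^ (r : ℝ) := by
  rcases eq_or_ne p q with rfl | hpq
  · obtain ⟨C, U, hU, hC⟩ := hf p
    exact ⟨C, mem_of_superset (prod_mem_nhds hU hU) fun z hz => hC z.1 hz.1 z.2 hz.2⟩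
  · have hcont : Continuous f := continuous_iff_continuousAt.mpr fun p => (hf p).continuousAt hr
    have hd : nndist p q ^ (r : ℝ) ≠ 0 := by simp [NNReal.rpow_eq_zero_iff, hpq]
    let C := (nndist (f p) (f q) + 1) / nndist p q ^ (r : ℝ)
    have hlt : ∀ᶠ z : X × X in 𝓝 (p, q),
        nndist (f z.1) (f z.2) < C * nndist z.1 z.2 ^ (r : ℝ) := by
      refine ContinuousAt.eventually_lt (by fun_prop) (continuousAt_const.mul
        ((NNReal.continuousAt_rpow_const (Or.inr r.coe_nonneg)).comp (by fun_prop))) ?_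
      simp only [C, div_mul_cancel₀ _ hd, lt_add_one]
    refine ⟨C, hlt.mono fun z hz => ?_⟩
    rw [edist_nndist, edist_nndist, ← ENNReal.coe_rpow_of_nonneg _ r.coe_nonneg]
    exact_mod_cast hz.le

theorem memHolder {X Y : Type*} [MetricSpace X] [CompactSpace X] [PseudoMetricSpace Y] {r : ℝ≥0}
    (hr : 0 < r) {f : X → Y} (hf : ∀ p, LocHolderAt r f p) : MemHolder r f := by
  suffices h : ∃ C : ℝ≥0, ∀ z ∈ (Set.univ : Set (X × X)),
      edist (f z.1) (f z.2) ≤ C * edist z.1 z.2 ^ (r : ℝ) from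
    let ⟨C, hC⟩ := h
    ⟨C, fun x y => hC (x, y) trivial⟩
  refine isCompact_univ.induction_on (p := fun S : Set (X × X) => ∃ C : ℝ≥0, ∀ z ∈ S,
    edist (f z.1) (f z.2) ≤ C * edist z.1 z.2 ^ (r : ℝ)) ⟨0, by simp⟩ ?_ ?_ ?_
  · rintro S T hST ⟨C, hC⟩
    exact ⟨C, fun z hz => hC z (hST hz)⟩
  · rintro S T ⟨C, hC⟩ ⟨C', hC'⟩
    refine ⟨max C C', ?_⟩
    rintro z (hz | hz)
    · exact (hC z hz).trans (by gcongr; exact le_max_left _ _)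
    · exact (hC' z hz).trans (by gcongr; exact le_max_right _ _)
  · rintro ⟨p, q⟩ -
    obtain ⟨C, hC⟩ := exists_eventually_edist_le hr hf p q
    exact ⟨_, nhdsWithin_le_nhds hC, C, fun _ hz => hz⟩

section Normed

variable {X E F : Type*} [PseudoMetricSpace X] [NormedAddCommGroup E] [NormedSpace ℝ E]
  [NormedAddCommGroup F] [NormedSpace ℝ F] {r : ℝ≥0}

theorem of_contDiffAt {f : E → F} {p : E} (hf : ContDiffAt ℝ 1 f p) : LocHolderAt 1 f p :=
  let ⟨K, U, hU, hK⟩ := hf.exists_lipschitzOnWith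
  ⟨K, U, hU, holderOnWith_one.mpr hK⟩

theorem contDiffAt_comp {Φ : E → F} {f : X → E} {p : X} (hΦ : ContDiffAt ℝ 1 Φ (f p))
    (hf : LocHolderAt r f p) (hr : 0 < r) : LocHolderAt r (fun x => Φ (f x)) p :=
  ((of_contDiffAt hΦ).comp hf (hf.continuousAt hr)).of_le (one_mul r).ge

theorem bilin {G : Type*} [NormedAddCommGroup G] [NormedSpace ℝ G] (B : E →L[ℝ] F →L[ℝ] G)
    {f : X → E} {g : X → F} {p : X} (hf : LocHolderAt r f p) (hg : LocHolderAt r g p)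
    (hr : 0 < r) : LocHolderAt r (fun x => B (f x) (g x)) p :=
  contDiffAt_comp B.isBoundedBilinearMap.contDiff.contDiffAt (hf.prodMk hg) hr

end Normed

end LocHolderAt

/-- `f` is continuously differentiable near `p` and its derivative is Hölder continuous with
exponent `r` near `p`. -/
structure C1HolderAt {E F : Type*} [NormedAddCommGroup E] [NormedSpace ℝ E]
    [NormedAddCommGroup F] [NormedSpace ℝ F] (r : ℝ≥0) (f : E → F) (p : E) : Prop where
  contDiffAt : ContDiffAt ℝ 1 f p
  fderiv : LocHolderAt r (fderiv ℝ f) p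

namespace C1HolderAt

variable {E F G : Type*} [NormedAddCommGroup E] [NormedSpace ℝ E] [NormedAddCommGroup F]
  [NormedSpace ℝ F] [NormedAddCommGroup G] [NormedSpace ℝ G] {r : ℝ≥0} {f : E → F} {p : E}

theorem of_contDiffAt (hf : ContDiffAt ℝ 2 f p) (hr : r ≤ 1) : C1HolderAt r f p :=
  ⟨hf.of_le (by norm_num),
    (LocHolderAt.of_contDiffAt (hf.fderiv_right (m := 1) (by norm_num))).of_le hr⟩

theorem comp {Φ : F → G} (hΦ : C1HolderAt r Φ (f p)) (hf : C1HolderAt r f p) (hr : 0 < r) :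
    C1HolderAt r (Φ ∘ f) p := by
  refine ⟨hΦ.contDiffAt.comp p hf.contDiffAt, ?_⟩
  have hΦf : LocHolderAt r (fun z => _root_.fderiv ℝ Φ (f z)) p :=
    (hΦ.fderiv.comp (LocHolderAt.of_contDiffAt hf.contDiffAt)
      hf.contDiffAt.continuousAt).of_le (mul_one r).ge
  have hcomp : LocHolderAt r (fun z => (_root_.fderiv ℝ Φ (f z)).comp (_root_.fderiv ℝ f z)) p :=
    .bilin (.compL ℝ E F G) hΦf hf.fderiv hr
  refine hcomp.congr ?_
  filter_upwards [hf.contDiffAt.eventually (by norm_num),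
    hf.contDiffAt.continuousAt.eventually (hΦ.contDiffAt.eventually (by norm_num))] with z hz hΦz
  exact (fderiv_comp z (hΦz.differentiableAt (by norm_num))
    (hz.differentiableAt (by norm_num))).symm

end C1HolderAt

namespace HolderC0

variable {X : Type} [MetricSpace X] {α : ℝ≥0}

theorem exists_of_memHolder {f : X → ℂ} (hα : 0 < α) (hf : MemHolder α f) :
    ∃ F : HolderC0 X α, ∀ x, F x = f x :=
  let ⟨_, hC⟩ := hf
  ⟨⟨⟨f, hC.continuous hα⟩, hf⟩, fun _ => rfl⟩

theorem ext {f g : HolderC0 X α} (h : ∀ x, f x = g x) : f = g :=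
  Subtype.ext (ContinuousMap.ext h)

variable [CompactSpace X]

theorem norm_le {f : HolderC0 X α} {M C : ℝ≥0} (hM : ∀ x, ‖f x‖ ≤ M) (hC : HolderWith C α f) :
    ‖f‖ ≤ M + C := by
  rw [norm_def]
  exact add_le_add ((ContinuousMap.norm_le _ M.coe_nonneg).mpr hM) hC.nnholderNorm_le

theorem norm_toCont_le (f : HolderC0 X α) : ‖f.toCont‖ ≤ ‖f‖ :=
  le_add_of_nonneg_right (NNReal.coe_nonneg _)

theorem norm_sub_le (f : HolderC0 X α) (x y : X) :
    ‖f x - f y‖ ≤ ‖f‖ * dist x y ^ (α : ℝ) := by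
  rw [← dist_eq_norm]
  refine (f.memHolder.holderWith.dist_le x y).trans ?_
  gcongr
  exact le_add_of_nonneg_left (norm_nonneg _)

theorem exists_clm {E : Type*} [NormedAddCommGroup E] [NormedSpace ℂ E] (S : E →ₗ[ℂ] X → ℂ)
    (M : ℝ≥0) (hα : 0 < α) (hM : ∀ u x, ‖S u x‖ ≤ M * ‖u‖)
    (hH : ∀ u x y, ‖S u x - S u y‖ ≤ M * ‖u‖ * dist x y ^ (α : ℝ)) :
    ∃ T : E →L[ℂ] HolderC0 X α, ∀ u x, T u x = S u x := by
  have hS : ∀ u, HolderWith (M * ‖u‖₊) α (S u) := fun u x y => by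
    rw [edist_nndist, edist_nndist, ← ENNReal.coe_rpow_of_nonneg _ α.coe_nonneg,
      ← ENNReal.coe_mul, ENNReal.coe_le_coe, ← NNReal.coe_le_coe]
    simpa [dist_eq_norm] using hH u x y
  choose T hT using fun u => exists_of_memHolder hα ⟨_, hS u⟩
  refine ⟨LinearMap.mkContinuous
    { toFun := T
      map_add' := fun u v => ext fun x => ?_
      map_smul' := fun c u => ext fun x => ?_ } (M + M) fun u => ?_, hT⟩
  · simp [hT, toCont_add]
  · simp [hT, toCont_smul]
  · rw [add_mul]
    exact norm_le (M := M * ‖u‖₊) (fun x => hT u x ▸ hM u x) (funext (hT u) ▸ hS u)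

theorem exists_mulCLM (hα : 0 < α) (a : HolderC0 X α) :
    ∃ T : HolderC0 X α →L[ℂ] HolderC0 X α, ∀ f x, T f x = a x * f x := by
  have hbound : ∀ (f : HolderC0 X α) x, ‖f x‖ ≤ ‖f‖ := fun f x =>
    (f.toCont.norm_coe_le_norm x).trans f.norm_toCont_le
  refine exists_clm
    { toFun := fun (f : HolderC0 X α) x => a x * f x
      map_add' := fun f g => funext fun x => by simp [toCont_add, mul_add]
      map_smul' := fun c f => funext fun x => by simp [toCont_smul, mul_left_comm] }
    (‖a‖₊ + ‖a‖₊) hα (fun f x => ?_) fun f x y => ?_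
  · simp only [LinearMap.coe_mk, AddHom.coe_mk, norm_mul, NNReal.coe_add, coe_nnnorm]
    exact (mul_le_mul (hbound a x) (hbound f x) (norm_nonneg _) (norm_nonneg _)).trans
      (by gcongr; exact le_add_of_nonneg_left (norm_nonneg _))
  · have hsplit : a x * f x - a y * f y = (a x - a y) * f x + a y * (f x - f y) := by ring
    calc ‖a x * f x - a y * f y‖ ≤ ‖a x - a y‖ * ‖f x‖ + ‖a y‖ * ‖f x - f y‖ := by
          rw [hsplit, ← norm_mul, ← norm_mul]
          exact norm_add_le _ _
      _ ≤ ‖a‖ * dist x y ^ (α : ℝ) * ‖f‖ + ‖a‖ * (‖f‖ * dist x y ^ (α : ℝ)) := by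
          gcongr
          exacts [a.norm_sub_le x y, hbound f x, hbound a y, f.norm_sub_le x y]
      _ = _ := by push_cast; ring

variable (X α) in
/-- The embedding of `C^{0,α}(X)` into `C(X)`. -/
noncomputable def toContCLM : HolderC0 X α →L[ℂ] C(X, ℂ) :=
  LinearMap.mkContinuous
    { toFun := toCont, map_add' := toCont_add, map_smul' := toCont_smul } 1
    fun f => by rw [one_mul]; exact norm_toCont_le f

theorem isCompactOperator_toContCLM (hα : 0 < α) : IsCompactOperator (toContCLM X α) := by
  let j := ContinuousMap.linearIsometryBoundedOfCompact X ℂ ℂ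
  let S : Set (BoundedContinuousFunction X ℂ) :=
    (fun f : HolderC0 X α => j f.toCont) '' Metric.closedBall 0 1
  have hS : IsCompact (closure S) := by
    refine BoundedContinuousFunction.arzela_ascoli (Metric.closedBall (0 : ℂ) 1)
      (isCompact_closedBall _ _) S ?_ ?_
    · rintro _ x ⟨f, hf, rfl⟩
      rw [mem_closedBall_zero_iff] at hf ⊢
      exact (f.toCont.norm_coe_le_norm x).trans ((norm_toCont_le f).trans hf)
    · refine Metric.equicontinuous_of_continuity_modulus (fun d : ℝ => d ^ (α : ℝ)) ?_ _ ?_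
      · have : ContinuousAt (fun d : ℝ => d ^ (α : ℝ)) 0 :=
          Real.continuousAt_rpow_const _ _ (Or.inr α.coe_nonneg)
        simpa [ContinuousAt, Real.zero_rpow (NNReal.coe_ne_zero.mpr hα.ne')] using this
      · rintro x y ⟨_, ⟨f, hf, rfl⟩⟩
        rw [mem_closedBall_zero_iff] at hf
        exact (dist_eq_norm (f x) (f y)).trans_le ((f.norm_sub_le x y).trans
          (mul_le_of_le_one_left (Real.rpow_nonneg dist_nonneg _) hf))
  refine (isCompactOperator_iff_image_closedBall_subset_compact
    (toContCLM X α : HolderC0 X α →ₗ[ℂ] C(X, ℂ)) one_pos).mpr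
    ⟨j.symm '' closure S, hS.image j.symm.continuous, ?_⟩
  rintro _ ⟨f, hf, rfl⟩
  exact ⟨j f.toCont, subset_closure ⟨f, hf, rfl⟩, j.symm_apply_apply _⟩

end HolderC0

/-- Upper Ahlfors regularity of dimension `d`: the measure of a ball of radius `r` is `O(r ^ d)`,
uniformly in its centre. -/
def IsUpperAhlforsRegular {X : Type*} [PseudoMetricSpace X] [MeasurableSpace X] (d : ℝ)
    (μ : Measure X) : Prop :=
  ∃ C : ℝ, ∀ x r, 0 ≤ r → μ (Metric.closedBall x r) ≤ ENNReal.ofReal (C * r ^ d)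

namespace IsUpperAhlforsRegular

variable {X : Type*} [MetricSpace X] [MeasurableSpace X] {μ : Measure X} {d s : ℝ}

theorem measure_singleton (hμ : IsUpperAhlforsRegular d μ) (hd : 0 < d) (x : X) : μ {x} = 0 := by
  obtain ⟨C, hC⟩ := hμ
  simpa [Real.zero_rpow hd.ne'] using hC x 0 le_rfl

theorem isFiniteMeasure [BoundedSpace X] (hμ : IsUpperAhlforsRegular d μ) : IsFiniteMeasure μ := by
  obtain ⟨C, hC⟩ := hμ
  rcases isEmpty_or_nonempty X with _ | ⟨⟨x⟩⟩
  · infer_instance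
  · obtain ⟨r, hr, hX⟩ := (Bornology.isBounded_univ.mpr ‹BoundedSpace X›).subset_closedBall_lt 0 x
    exact ⟨(measure_mono hX).trans_lt ((hC x r hr.le).trans_lt ENNReal.ofReal_lt_top)⟩

theorem exists_measure_inv_dist_rpow_ge_le (hμ : IsUpperAhlforsRegular d μ) (hs : 0 < s) :
    ∃ C : ℝ, ∀ x t, 0 < t →
      μ {y | t ≤ (dist x y)⁻¹ ^ s} ≤ ENNReal.ofReal (C * t ^ (-(d / s))) := by
  obtain ⟨C, hC⟩ := hμ
  refine ⟨C, fun x t ht => ?_⟩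
  have hball : {y | t ≤ (dist x y)⁻¹ ^ s} ⊆ Metric.closedBall x (t ^ s⁻¹)⁻¹ := fun y hy => by
    rw [Metric.mem_closedBall']
    exact le_inv_of_le_inv₀ (by positivity)
      ((Real.rpow_inv_le_iff_of_pos ht.le (inv_nonneg.mpr dist_nonneg) hs).mpr hy)
  have hpow : ((t ^ s⁻¹)⁻¹) ^ d = t ^ (-(d / s)) := by
    rw [← Real.rpow_neg ht.le, ← Real.rpow_mul ht.le]
    congr 1
    ring
  exact (measure_mono hball).trans ((hC x _ (by positivity)).trans_eq (by rw [hpow]))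

variable [BorelSpace X] [IsFiniteMeasure μ]

theorem exists_lintegral_inv_dist_rpow_le (hμ : IsUpperAhlforsRegular d μ) (hs : 0 < s)
    (hsd : s < d) :
    ∃ A : ℝ≥0∞, A ≠ ∞ ∧ ∀ x, ∫⁻ y, ENNReal.ofReal ((dist x y)⁻¹ ^ s) ∂μ ≤ A := by
  obtain ⟨C, hC⟩ := hμ.exists_measure_inv_dist_rpow_ge_le hs
  have hexp : -(d / s) < -1 := neg_lt_neg ((one_lt_div₀ hs).mpr hsd)
  have hint : IntegrableOn (fun t : ℝ => C * t ^ (-(d / s))) (Set.Ioi 1) :=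
    (integrableOn_Ioi_rpow_of_lt hexp zero_lt_one).const_mul C
  refine ⟨μ Set.univ + ∫⁻ t in Set.Ioi (1 : ℝ), ENNReal.ofReal (C * t ^ (-(d / s))),
    ENNReal.add_ne_top.mpr ⟨measure_ne_top _ _, hint.lintegral_lt_top.ne⟩, fun x => ?_⟩
  rw [lintegral_eq_lintegral_meas_le μ (Eventually.of_forall fun y => by positivity)
    (by fun_prop), ← Set.Ioc_union_Ioi_eq_Ioi zero_le_one,
    lintegral_union measurableSet_Ioi Set.Ioc_disjoint_Ioi_same]
  gcongr ?_ + ?_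
  · refine (setLIntegral_mono measurable_const
      fun t _ => measure_mono (Set.subset_univ _)).trans ?_
    simp
  · exact setLIntegral_mono (by fun_prop) fun t ht => hC x t (zero_lt_one.trans ht)

theorem exists_integral_inv_dist_rpow_le (hμ : IsUpperAhlforsRegular d μ) (hs : 0 ≤ s)
    (hsd : s < d) :
    ∃ A : ℝ≥0, ∀ x, Integrable (fun y => (dist x y)⁻¹ ^ s) μ ∧
      ∫ y, (dist x y)⁻¹ ^ s ∂μ ≤ A := by
  rcases hs.eq_or_lt with rfl | hs
  · exact ⟨(μ.real Set.univ).toNNReal, fun x => by simp⟩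
  · obtain ⟨A, hA, hle⟩ := hμ.exists_lintegral_inv_dist_rpow_le hs hsd
    have hnn : ∀ x, 0 ≤ᵐ[μ] fun y => (dist x y)⁻¹ ^ s := fun x =>
      Eventually.of_forall fun y => by positivity
    have hmeas : ∀ x, AEStronglyMeasurable (fun y => (dist x y)⁻¹ ^ s) μ := fun x =>
      Measurable.aestronglyMeasurable (by fun_prop)
    refine ⟨A.toNNReal, fun x => ⟨⟨hmeas x, ?_⟩, ?_⟩⟩
    · rw [hasFiniteIntegral_iff_ofReal (hnn x)]
      exact (hle x).trans_lt hA.lt_top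
    · rw [integral_eq_lintegral_of_nonneg_ae (hnn x) (hmeas x)]
      exact ENNReal.toReal_mono hA (hle x)

end IsUpperAhlforsRegular

theorem pow_mul_pow_le_pow_add_pow {a b : ℝ} (ha : 0 ≤ a) (hb : 0 ≤ b) (m n : ℕ) :
    a ^ m * b ^ n ≤ a ^ (m + n) + b ^ (m + n) := by
  rcases le_total a b with h | h
  · calc a ^ m * b ^ n ≤ b ^ m * b ^ n := by gcongr
      _ ≤ _ := by rw [← pow_add]; linarith [pow_nonneg ha (m + n)]
  · calc a ^ m * b ^ n ≤ a ^ m * a ^ n := by gcongr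
      _ ≤ _ := by rw [← pow_add]; linarith [pow_nonneg hb (m + n)]

theorem le_rpow_mul_of_le_pow_of_le_pow_succ {Δ B δ a b α : ℝ} {s : ℕ} (hα : 0 ≤ α) (hα1 : α ≤ 1)
    (ha : 0 < a) (hb : 0 < b) (hδ : 0 ≤ δ) (hB : 0 ≤ B) (h : Δ ≤ B * (a ^ s + b ^ s))
    (h' : Δ ≤ B * δ * (a ^ (s + 1) + b ^ (s + 1))) :
    Δ ≤ 2 * B * δ ^ α * (a ^ (s + α) + b ^ (s + α)) := by
  wlog hba : b ≤ a generalizing a b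
  · rw [add_comm (a ^ (s + α))]
    exact this hb ha (add_comm (a ^ s) _ ▸ h) (add_comm (a ^ (s + 1)) _ ▸ h') (le_of_not_ge hba)
  have hbs : 0 ≤ b ^ (s + α) := by positivity
  have hmin : min 1 (δ * a) ≤ (δ * a) ^ α := by
    rcases le_total (δ * a) 1 with hle | hle
    · exact (min_le_right _ _).trans (Real.self_le_rpow_of_le_one (by positivity) hle hα1)
    · exact (min_le_left _ _).trans (Real.one_le_rpow hle hα)
  calc Δ ≤ 2 * B * a ^ s * min 1 (δ * a) := by
        rw [mul_min_of_nonneg _ _ (by positivity), mul_one]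
        refine le_min (h.trans ?_) (h'.trans ?_)
        · calc B * (a ^ s + b ^ s) ≤ B * (a ^ s + a ^ s) := by gcongr
            _ = _ := by ring
        · calc B * δ * (a ^ (s + 1) + b ^ (s + 1)) ≤ B * δ * (a ^ (s + 1) + a ^ (s + 1)) := by
                gcongr
            _ = _ := by ring
    _ ≤ 2 * B * a ^ s * (δ * a) ^ α := by gcongr
    _ = 2 * B * δ ^ α * a ^ (s + α) := by
        rw [Real.mul_rpow hδ ha.le, Real.rpow_add ha, Real.rpow_natCast]
        ring
    _ ≤ _ := by gcongr; linarith

section DiffQuot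

variable {X : Type*} [MetricSpace X]

/-- The kernel `1 / |x - y|`, with value `0` on the diagonal. -/
noncomputable def invDist (x y : X) : ℂ := ((dist x y)⁻¹ : ℝ)

/-- The difference quotient `(q x - q y) / |x - y|` of a function `q`, with value `0` on the
diagonal. -/
noncomputable def diffQuot (q : X → ℂ) (x y : X) : ℂ := (q x - q y) * invDist x y

theorem norm_invDist (x y : X) : ‖invDist x y‖ = (dist x y)⁻¹ := by
  rw [invDist, Complex.norm_real, Real.norm_of_nonneg (inv_nonneg.mpr dist_nonneg)]

theorem norm_invDist_sub_le {x x' y : X} (hx : x ≠ y) (hx' : x' ≠ y) :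
    ‖invDist x y - invDist x' y‖ ≤ dist x x' * ((dist x y)⁻¹ * (dist x' y)⁻¹) := by
  have h1 := dist_pos.mpr hx
  have h2 := dist_pos.mpr hx'
  rw [invDist, invDist, ← Complex.ofReal_sub, Complex.norm_real, inv_sub_inv h1.ne' h2.ne',
    norm_div, norm_mul, Real.norm_of_nonneg h1.le, Real.norm_of_nonneg h2.le, div_eq_mul_inv,
    mul_inv]
  gcongr
  rw [Real.norm_eq_abs, abs_sub_comm]
  exact abs_dist_sub_le x x' y

variable {q : X → ℂ} {L : ℝ≥0}

theorem norm_diffQuot_le (hq : LipschitzWith L q) (x y : X) : ‖diffQuot q x y‖ ≤ L := by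
  rw [diffQuot, norm_mul, norm_invDist, ← div_eq_mul_inv, ← dist_eq_norm]
  exact div_le_of_le_mul₀ dist_nonneg L.coe_nonneg (hq.dist_le_mul x y)

theorem norm_diffQuot_sub_le (hq : LipschitzWith L q) {x y : X} (hx : x ≠ y) (x' : X) :
    ‖diffQuot q x y - diffQuot q x' y‖ ≤ 2 * L * dist x x' * (dist x y)⁻¹ := by
  have hpos := dist_pos.mpr hx
  rcases eq_or_ne x' y with rfl | hx'
  · have hdiag : diffQuot q x' x' = 0 := by simp [diffQuot]
    rw [hdiag, sub_zero, mul_assoc, mul_inv_cancel₀ hpos.ne']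
    linarith [norm_diffQuot_le hq x x', L.coe_nonneg]
  · have hpos' := dist_pos.mpr hx'
    have hsplit : diffQuot q x y - diffQuot q x' y =
        (q x - q x') * invDist x y + (q x' - q y) * (invDist x y - invDist x' y) := by
      simp only [diffQuot]; ring
    have hlip : ∀ u v, ‖q u - q v‖ ≤ L * dist u v := fun u v =>
      dist_eq_norm (q u) (q v) ▸ hq.dist_le_mul u v
    calc ‖diffQuot q x y - diffQuot q x' y‖
        ≤ ‖q x - q x'‖ * ‖invDist x y‖ + ‖q x' - q y‖ * ‖invDist x y - invDist x' y‖ := by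
          rw [hsplit, ← norm_mul, ← norm_mul]
          exact norm_add_le _ _
      _ ≤ L * dist x x' * (dist x y)⁻¹ +
          L * dist x' y * (dist x x' * ((dist x y)⁻¹ * (dist x' y)⁻¹)) := by
          gcongr
          exacts [hlip _ _, (norm_invDist x y).le, hlip _ _, norm_invDist_sub_le hx hx']
      _ = _ := by field_simp; ring

variable [MeasurableSpace X] [BorelSpace X]

theorem measurable_invDist (x : X) : Measurable (invDist x) := by
  unfold invDist
  fun_prop

theorem measurable_diffQuot (hq : Continuous q) (x : X) : Measurable (diffQuot q x) :=
  (measurable_const.sub hq.measurable).mul (measurable_invDist x)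

end DiffQuot

/-- Standard singular kernels of order `s`: `h` is `O(|x - y| ^ (-s))` and its variation in the
first variable is that of a function whose gradient is `O(|x - y| ^ (-s-1))`. The estimate of the
variation is stated in a form symmetric in `x` and `x'`, so that no condition on the size of
`|x - x'|` is needed. -/
structure IsSingularKernel {X : Type*} [MetricSpace X] [MeasurableSpace X] (s : ℕ)
    (h : X → X → ℂ) : Prop where
  measurable : ∀ x, Measurable (h x)
  exists_bound : ∃ B : ℝ≥0, (∀ x y, ‖h x y‖ ≤ B * (dist x y)⁻¹ ^ s) ∧
    ∀ x x' y, x ≠ y → x' ≠ y → ‖h x y - h x' y‖ ≤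
      B * dist x x' * ((dist x y)⁻¹ ^ (s + 1) + (dist x' y)⁻¹ ^ (s + 1))

namespace IsSingularKernel

section Metric

variable {X : Type*} [MetricSpace X] [MeasurableSpace X] {s m n : ℕ} {h k : X → X → ℂ}

theorem mul (hh : IsSingularKernel m h) (hk : IsSingularKernel n k) :
    IsSingularKernel (m + n) (fun x y => h x y * k x y) := by
  obtain ⟨B, hB, hB'⟩ := hh.exists_bound
  obtain ⟨C, hC, hC'⟩ := hk.exists_bound
  refine ⟨fun x => (hh.measurable x).mul (hk.measurable x), 3 * (B * C), fun x y => ?_,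
    fun x x' y hx hx' => ?_⟩
  · have hBC : 0 ≤ (B : ℝ) * C * (dist x y)⁻¹ ^ (m + n) := by positivity
    calc ‖h x y * k x y‖ ≤ (B * (dist x y)⁻¹ ^ m) * (C * (dist x y)⁻¹ ^ n) := by
          rw [norm_mul]
          gcongr
          exacts [hB x y, hC x y]
      _ ≤ _ := by push_cast; rw [pow_add] at hBC ⊢; linarith
  · have hsplit : h x y * k x y - h x' y * k x' y =
        (h x y - h x' y) * k x y + h x' y * (k x y - k x' y) := by ring
    set a := (dist x y)⁻¹
    set b := (dist x' y)⁻¹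
    have ha : 0 ≤ a := inv_nonneg.mpr dist_nonneg
    have hb : 0 ≤ b := inv_nonneg.mpr dist_nonneg
    have hab := pow_mul_pow_le_pow_add_pow hb ha (m + 1) n
    have hab' := pow_mul_pow_le_pow_add_pow hb ha m (n + 1)
    calc ‖h x y * k x y - h x' y * k x' y‖
        ≤ ‖h x y - h x' y‖ * ‖k x y‖ + ‖h x' y‖ * ‖k x y - k x' y‖ := by
          rw [hsplit, ← norm_mul, ← norm_mul]
          exact norm_add_le _ _
      _ ≤ (B * dist x x' * (a ^ (m + 1) + b ^ (m + 1))) * (C * a ^ n) +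
          (B * b ^ m) * (C * dist x x' * (a ^ (n + 1) + b ^ (n + 1))) := by
          gcongr
          exacts [hB' x x' y hx hx', hC x y, hB x' y, hC' x x' y hx hx']
      _ = B * C * dist x x' * (a ^ (m + n + 1) + b ^ (m + 1) * a ^ n + b ^ m * a ^ (n + 1) +
          b ^ (m + n + 1)) := by ring
      _ ≤ B * C * dist x x' * (3 * (a ^ (m + n + 1) + b ^ (m + n + 1))) := by
          rw [add_right_comm] at hab
          rw [← add_assoc] at hab'
          gcongr
          linarith
      _ = _ := by push_cast; ring

theorem exists_norm_sub_le_rpow (hh : IsSingularKernel s h) {α : ℝ} (hα : 0 ≤ α) (hα1 : α ≤ 1) :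
    ∃ B : ℝ≥0, ∀ x x' y, x ≠ y → x' ≠ y → ‖h x y - h x' y‖ ≤
      B * dist x x' ^ α * ((dist x y)⁻¹ ^ (s + α) + (dist x' y)⁻¹ ^ (s + α)) := by
  obtain ⟨B, hB, hB'⟩ := hh.exists_bound
  refine ⟨2 * B, fun x x' y hx hx' => ?_⟩
  refine le_rpow_mul_of_le_pow_of_le_pow_succ hα hα1 (inv_pos.mpr (dist_pos.mpr hx))
    (inv_pos.mpr (dist_pos.mpr hx')) dist_nonneg B.coe_nonneg ?_ (hB' x x' y hx hx')
  rw [mul_add]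
  exact (norm_sub_le _ _).trans (add_le_add (hB x y) (hB x' y))

variable [BorelSpace X]

theorem invDist : IsSingularKernel 1 (invDist : X → X → ℂ) := by
  refine ⟨measurable_invDist, 1, fun x y => by simp [norm_invDist], fun x x' y hx hx' => ?_⟩
  rw [NNReal.coe_one, one_mul]
  refine (norm_invDist_sub_le hx hx').trans ?_
  gcongr
  simpa using pow_mul_pow_le_pow_add_pow (inv_nonneg.mpr (dist_nonneg (x := x) (y := y)))
    (inv_nonneg.mpr (dist_nonneg (x := x') (y := y))) 1 1

theorem diffQuot {q : X → ℂ} {L : ℝ≥0} (hq : LipschitzWith L q) :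
    IsSingularKernel 0 (diffQuot q) := by
  refine ⟨measurable_diffQuot hq.continuous, 2 * L, fun x y => ?_, fun x x' y hx _ => ?_⟩
  · push_cast
    linarith [norm_diffQuot_le hq x y, L.coe_nonneg]
  · refine (norm_diffQuot_sub_le hq hx x').trans ?_
    push_cast
    gcongr
    simp

end Metric

section Compact

variable {X : Type*} [MetricSpace X] [CompactSpace X] [MeasurableSpace X] [BorelSpace X]
  {μ : Measure X} {s : ℕ} {d : ℝ} {h : X → X → ℂ}

theorem exists_bound_integral_mul (hh : IsSingularKernel s h) (hμ : IsUpperAhlforsRegular d μ)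
    (hs : s < d) :
    ∃ M : ℝ≥0, ∀ (ψ : C(X, ℂ)) x, Integrable (fun y => h x y * ψ y) μ ∧
      ‖∫ y, h x y * ψ y ∂μ‖ ≤ M * ‖ψ‖ := by
  have := hμ.isFiniteMeasure
  obtain ⟨B, hB, -⟩ := hh.exists_bound
  obtain ⟨A, hA⟩ := hμ.exists_integral_inv_dist_rpow_le s.cast_nonneg hs
  simp only [Real.rpow_natCast] at hA
  have hbound : ∀ (ψ : C(X, ℂ)) x y, ‖h x y * ψ y‖ ≤ B * (dist x y)⁻¹ ^ s * ‖ψ‖ := by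
    intro ψ x y
    rw [norm_mul]
    gcongr
    exacts [hB x y, ψ.norm_coe_le_norm y]
  have hint : ∀ (ψ : C(X, ℂ)) x, Integrable (fun y => B * (dist x y)⁻¹ ^ s * ‖ψ‖) μ := fun ψ x =>
    ((hA x).1.const_mul _).mul_const _
  refine ⟨B * A, fun ψ x => ⟨(hint ψ x).mono'
    ((hh.measurable x).mul ψ.continuous.measurable).aestronglyMeasurable
    (Eventually.of_forall (hbound ψ x)), ?_⟩⟩
  refine (norm_integral_le_of_norm_le (hint ψ x) (Eventually.of_forall (hbound ψ x))).trans ?_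
  rw [integral_mul_const, integral_const_mul, NNReal.coe_mul]
  gcongr
  exact (hA x).2

theorem integrable_mul (hh : IsSingularKernel s h) (hμ : IsUpperAhlforsRegular d μ)
    (hs : s < d) (ψ : C(X, ℂ)) (x : X) : Integrable (fun y => h x y * ψ y) μ :=
  let ⟨_, hM⟩ := hh.exists_bound_integral_mul hμ hs
  (hM ψ x).1

theorem exists_bound_integral_mul_sub (hh : IsSingularKernel s h)
    (hμ : IsUpperAhlforsRegular d μ) {α : ℝ} (hα : 0 ≤ α) (hα1 : α ≤ 1) (hs : s + α < d) :
    ∃ M : ℝ≥0, ∀ (ψ : C(X, ℂ)) x x',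
      ‖∫ y, h x y * ψ y ∂μ - ∫ y, h x' y * ψ y ∂μ‖ ≤ M * ‖ψ‖ * dist x x' ^ α := by
  have := hμ.isFiniteMeasure
  have hsα : (0 : ℝ) ≤ s + α := by positivity
  obtain ⟨B, hB⟩ := hh.exists_norm_sub_le_rpow hα hα1
  obtain ⟨A, hA⟩ := hμ.exists_integral_inv_dist_rpow_le hsα hs
  have hint := hh.integrable_mul hμ ((le_add_of_nonneg_right hα).trans_lt hs)
  refine ⟨2 * B * A, fun ψ x x' => ?_⟩
  have hne : ∀ x, ∀ᵐ y ∂μ, x ≠ y := fun x => by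
    filter_upwards [compl_mem_ae_iff.mpr (hμ.measure_singleton (hsα.trans_lt hs) x)] with y hy
    exact Ne.symm hy
  have hbound : ∀ᵐ y ∂μ, ‖h x y * ψ y - h x' y * ψ y‖ ≤
      B * dist x x' ^ α * ((dist x y)⁻¹ ^ (s + α) + (dist x' y)⁻¹ ^ (s + α)) * ‖ψ‖ := by
    filter_upwards [hne x, hne x'] with y hx hx'
    rw [← sub_mul, norm_mul]
    gcongr
    exacts [hB x x' y hx hx', ψ.norm_coe_le_norm y]
  rw [← integral_sub (hint ψ x) (hint ψ x')]
  refine (norm_integral_le_of_norm_le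
    ((((hA x).1.add (hA x').1).const_mul _).mul_const _) hbound).trans ?_
  calc ∫ y, B * dist x x' ^ α * ((dist x y)⁻¹ ^ (s + α) + (dist x' y)⁻¹ ^ (s + α)) * ‖ψ‖ ∂μ
      = B * dist x x' ^ α *
        (∫ y, (dist x y)⁻¹ ^ (s + α) ∂μ + ∫ y, (dist x' y)⁻¹ ^ (s + α) ∂μ) * ‖ψ‖ := by
        rw [integral_mul_const, integral_const_mul, integral_add (hA x).1 (hA x').1]
    _ ≤ B * dist x x' ^ α * (A + A) * ‖ψ‖ := by
        gcongr
        exacts [(hA x).2, (hA x').2]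
    _ = _ := by push_cast; ring

theorem exists_clm_holderC0 {X : Type} [MetricSpace X] [CompactSpace X] [MeasurableSpace X]
    [BorelSpace X] {μ : Measure X} {h : X → X → ℂ} (hh : IsSingularKernel s h)
    (hμ : IsUpperAhlforsRegular d μ) {α : ℝ≥0} (hα : 0 < α) (hα1 : α ≤ 1) (hs : s + α < d) :
    ∃ T : C(X, ℂ) →L[ℂ] HolderC0 X α, ∀ ψ x, T ψ x = ∫ y, h x y * ψ y ∂μ := by
  have hsd : (s : ℝ) < d := (le_add_of_nonneg_right α.coe_nonneg).trans_lt hs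
  obtain ⟨M, hM⟩ := hh.exists_bound_integral_mul hμ hsd
  obtain ⟨N, hN⟩ := hh.exists_bound_integral_mul_sub hμ α.coe_nonneg hα1 hs
  refine HolderC0.exists_clm
    { toFun := fun (ψ : C(X, ℂ)) x => ∫ y, h x y * ψ y ∂μ
      map_add' := fun ψ χ => funext fun x => ?_
      map_smul' := fun c ψ => funext fun x => ?_ } (M + N) hα (fun ψ x => ?_) fun ψ x y => ?_
  · simp only [ContinuousMap.add_apply, mul_add, Pi.add_apply]
    exact integral_add (hM ψ x).1 (hM χ x).1
  · simp only [ContinuousMap.smul_apply, smul_eq_mul, mul_left_comm, Pi.smul_apply,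
      RingHom.id_apply]
    exact integral_const_mul c _
  · exact (hM ψ x).2.trans (by gcongr; exact le_self_add)
  · exact (hN ψ x y).trans (by gcongr; exact le_add_self)

end Compact

end IsSingularKernel

/-- The gradient of a defining function `g`, normalized to length one; it is the outward unit
normal of `{g < 0}`. -/
noncomputable def unitGradient {E : Type*} [NormedAddCommGroup E] [InnerProductSpace ℝ E]
    [CompleteSpace E] (g : E → ℝ) (x : E) : E :=
  ‖gradient g x‖⁻¹ • gradient g x

theorem isOutwardUnitNormal_unitGradient {Ω : Set E3} {g : E3 → ℝ} {x : E3}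
    (hd : DifferentiableAt ℝ g x) (hg : fderiv ℝ g x ≠ 0) (hx : g x = 0)
    (hlt : ∀ᶠ y in 𝓝 x, g y < 0 → y ∈ Ω) (hle : ∀ᶠ y in 𝓝 x, y ∈ closure Ω → g y ≤ 0)
    (hfr : ∀ᶠ y in 𝓝 x, y ∈ frontier Ω → g y = 0) :
    IsOutwardUnitNormal Ω x (unitGradient g x) := by
  have hm : gradient g x ≠ 0 := (map_ne_zero_iff _ (LinearIsometryEquiv.injective _)).mpr hg
  set n := unitGradient g x with hn
  refine ⟨by simp [hn, unitGradient, norm_smul, hm], ?_, ?_⟩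
  · have hlin : (fun y => inner ℝ (gradient g x) (y - x)) =o[𝓝[frontier Ω] x] (fun y => y - x) := by
      refine ((hasGradientAt_iff_isLittleO.mp hd.hasGradientAt).mono
        nhdsWithin_le_nhds).neg_left.congr' ?_ .rfl
      filter_upwards [self_mem_nhdsWithin, nhdsWithin_le_nhds hfr] with y hy hfr
      simp [hfr hy, hx]
    exact (hlin.const_mul_left ‖gradient g x‖⁻¹).congr_left fun y => by
      simp only [hn, unitGradient, real_inner_smul_left]
  · have hline : HasDerivAt (fun t : ℝ => x + t • n) n 0 := by
      simpa using ((hasDerivAt_id (0 : ℝ)).smul_const n).const_add x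
    have hderiv : HasDerivAt (fun t : ℝ => g (x + t • n)) ‖gradient g x‖ 0 := by
      have hn_apply : fderiv ℝ g x n = ‖gradient g x‖ := by
        rw [← inner_gradient_left, hn, unitGradient, real_inner_smul_right,
          real_inner_self_eq_norm_mul_norm, inv_mul_cancel_left₀ (norm_ne_zero_iff.mpr hm)]
      rw [← hn_apply]
      refine HasFDerivAt.comp_hasDerivAt (0 : ℝ) ?_ hline
      simpa using hd.hasFDerivAt
    have hsign := eventually_nhdsWithin_sign_eq_of_deriv_pos
      (hderiv.deriv ▸ norm_pos_iff.mpr hm) (by simpa using hx)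
    have hnear {p : E3 → Prop} (hp : ∀ᶠ y in 𝓝 x, p y) : ∀ᶠ t : ℝ in 𝓝 0, p (x + t • n) :=
      hline.continuousAt.eventually (by simpa using hp)
    have hneg : Tendsto (fun t : ℝ => -t) (𝓝[>] 0) (𝓝 0) := by
      simpa using (tendsto_neg (0 : ℝ)).mono_left nhdsWithin_le_nhds
    filter_upwards [nhdsWithin_le_nhds hsign, nhdsWithin_le_nhds (hnear hle), hneg.eventually hsign,
      hneg.eventually (hnear hlt), self_mem_nhdsWithin] with t hpos hout hneg hin (ht : 0 < t)
    rw [sub_zero, sign_pos ht, sign_eq_one_iff] at hpos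
    rw [sub_zero, sign_neg (neg_neg_of_pos ht), sign_eq_neg_one_iff] at hneg
    exact ⟨fun hc => (hout hc).not_gt hpos, by simpa [sub_eq_add_neg] using hin hneg⟩

/-- The height of a point above the graph of `f` in the Cartesian coordinates `e`: a defining
function of a domain lying below this graph. -/
noncomputable def graphHeight (e : E3 ≃ᵃⁱ[ℝ] WithLp 2 (E2 × ℝ)) (f : E2 → ℝ) (z : E3) : ℝ :=
  (e z).snd - f (e z).fst

section GraphHeight

variable (e : E3 ≃ᵃⁱ[ℝ] WithLp 2 (E2 × ℝ)) {f : E2 → ℝ} {r : ℝ≥0}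

theorem hasFDerivAt_chart (z : E3) :
    HasFDerivAt e (e.linearIsometryEquiv : E3 →L[ℝ] WithLp 2 (E2 × ℝ)) z := by
  have he : (e : E3 → WithLp 2 (E2 × ℝ)) = fun w => e.linearIsometryEquiv w + e 0 := by
    funext w
    simpa using e.map_vadd 0 w
  rw [he]
  exact (e.linearIsometryEquiv : E3 →L[ℝ] WithLp 2 (E2 × ℝ)).hasFDerivAt.add_const _

/-- The derivative of the projection of `ℝ³` to the base plane of the coordinates `e`. -/
noncomputable def chartFst : E3 →L[ℝ] E2 :=
  (WithLp.fstL 2 ℝ E2 ℝ).comp (e.linearIsometryEquiv : E3 →L[ℝ] WithLp 2 (E2 × ℝ))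

/-- The derivative of the vertical coordinate of the coordinates `e`. -/
noncomputable def chartSnd : E3 →L[ℝ] ℝ :=
  (WithLp.sndL 2 ℝ E2 ℝ).comp (e.linearIsometryEquiv : E3 →L[ℝ] WithLp 2 (E2 × ℝ))

theorem contDiff_chart_fst {n : WithTop ℕ∞} : ContDiff ℝ n fun z => (e z).fst :=
  (WithLp.fstL 2 ℝ E2 ℝ).contDiff.comp
    e.toContinuousAffineEquiv.toContinuousAffineMap.contDiff

theorem hasFDerivAt_graphHeight {z : E3} (hf : DifferentiableAt ℝ f (e z).fst) :
    HasFDerivAt (graphHeight e f) (chartSnd e - (fderiv ℝ f (e z).fst).comp (chartFst e)) z :=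
  ((WithLp.sndL 2 ℝ E2 ℝ).hasFDerivAt.comp z (hasFDerivAt_chart e z)).sub
    (hf.hasFDerivAt.comp z
      ((WithLp.fstL 2 ℝ E2 ℝ).hasFDerivAt.comp z (hasFDerivAt_chart e z)))

theorem fderiv_graphHeight (hf : Differentiable ℝ f) :
    fderiv ℝ (graphHeight e f) =
      fun z => chartSnd e - (fderiv ℝ f (e z).fst).comp (chartFst e) :=
  funext fun _ => (hasFDerivAt_graphHeight e hf.differentiableAt).fderiv

theorem fderiv_graphHeight_ne_zero {z : E3} (hf : DifferentiableAt ℝ f (e z).fst) :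
    fderiv ℝ (graphHeight e f) z ≠ 0 := fun h => by
  have hvert := congrArg (fun T : E3 →L[ℝ] ℝ =>
    T (e.linearIsometryEquiv.symm (WithLp.toLp 2 (0, 1)))) h
  simp [(hasFDerivAt_graphHeight e hf).fderiv, chartFst, chartSnd] at hvert

theorem c1HolderAt_fderiv_graphHeight (hf : ContDiff ℝ 2 f)
    (hfr : MemHolder r (fderiv ℝ (fderiv ℝ f))) (hr : 0 < r) (hr1 : r ≤ 1) (z : E3) :
    C1HolderAt r (fderiv ℝ (graphHeight e f)) z := by
  have hdf : C1HolderAt r (fderiv ℝ f) (e z).fst :=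
    ⟨(hf.fderiv_right (by norm_num)).contDiffAt, .of_memHolder hfr⟩
  have haff : ContDiff ℝ 2 fun T : E2 →L[ℝ] ℝ => chartSnd e - T.comp (chartFst e) := by fun_prop
  rw [fderiv_graphHeight e (hf.differentiable (by norm_num))]
  exact (C1HolderAt.of_contDiffAt haff.contDiffAt hr1).comp (f := fun z => fderiv ℝ f (e z).fst)
    (hdf.comp (f := fun z => (e z).fst)
      (.of_contDiffAt (contDiff_chart_fst e).contDiffAt hr1) hr) hr

end GraphHeight

section UnitGradient

variable {E : Type*} [NormedAddCommGroup E] [InnerProductSpace ℝ E] [CompleteSpace E]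

theorem continuousAt_unitGradient {g : E → ℝ} {z : E} (hg : ContinuousAt (fderiv ℝ g) z)
    (hg0 : fderiv ℝ g z ≠ 0) : ContinuousAt (unitGradient g) z := by
  have hgrad : ContinuousAt (gradient g) z :=
    (InnerProductSpace.toDual ℝ E).symm.continuous.continuousAt.comp hg
  have hne : gradient g z ≠ 0 := (map_ne_zero_iff _ (LinearIsometryEquiv.injective _)).mpr hg0
  exact (hgrad.norm.inv₀ (norm_ne_zero_iff.mpr hne)).smul hgrad

theorem C1HolderAt.unitGradient {r : ℝ≥0} {g : E → ℝ} {z : E}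
    (hg : C1HolderAt r (_root_.fderiv ℝ g) z) (hg0 : _root_.fderiv ℝ g z ≠ 0) (hr : 0 < r)
    (hr1 : r ≤ 1) : C1HolderAt r (_root_.unitGradient g) z := by
  let R : (E →L[ℝ] ℝ) →L[ℝ] E := LinearMap.mkContinuous
    { toFun := (InnerProductSpace.toDual ℝ E).symm
      map_add' := fun φ ψ => by simp
      map_smul' := fun c φ => by simp } 1 fun φ => by simp
  have hR : R (_root_.fderiv ℝ g z) ≠ 0 :=
    (map_ne_zero_iff _ (LinearIsometryEquiv.injective _)).mpr hg0
  have hΦ : ContDiffAt ℝ 2 (fun T => ‖R T‖⁻¹ • R T) (_root_.fderiv ℝ g z) :=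
    ((R.contDiff.contDiffAt.norm ℝ hR).inv (norm_ne_zero_iff.mpr hR)).smul R.contDiff.contDiffAt
  exact (C1HolderAt.of_contDiffAt hΦ hr1).comp hg hr

end UnitGradient

namespace HolderDomain

variable {α : ℝ≥0} (D : HolderDomain α)

theorem normal_eq_unitGradient {e : E3 ≃ᵃⁱ[ℝ] WithLp 2 (E2 × ℝ)} {f : E2 → ℝ} {W : Set E3}
    (hf : ContDiff ℝ 2 f) (hW : IsOpen W)
    (h : ∀ y ∈ W, (y ∈ D.carrier ↔ (e y).snd < f (e y).fst)) (x : D.Γ) (hx : (x : E3) ∈ W) :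
    D.normal x = unitGradient (graphHeight e f) x := by
  have hdf : Differentiable ℝ f := hf.differentiable (by norm_num)
  have hgraph {y : E3} (hy : y ∈ W) := D.mem_frontier_of_graph hf.continuous hW h hy
  refine (D.normal_unique x (isOutwardUnitNormal_unitGradient
    (hasFDerivAt_graphHeight e hdf.differentiableAt).differentiableAt
    (fderiv_graphHeight_ne_zero e hdf.differentiableAt)
    (sub_eq_zero.mpr ((hgraph hx).1.mp x.2)) ?_ ?_ ?_)).symm
  all_goals filter_upwards [hW.mem_nhds hx] with y hy
  · exact fun hlt => (h y hy).mpr (sub_neg.mp hlt)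
  · exact fun hc => sub_nonpos.mpr ((hgraph hy).2 hc)
  · exact fun hfr => sub_eq_zero.mpr ((hgraph hy).1.mp hfr)

theorem continuous_normal : Continuous D.normal := by
  refine continuous_iff_continuousAt.mpr fun p => ?_
  obtain ⟨e, f, W, hf, -, hW, hpW, h⟩ := D.local_graph p p.2
  have hdf : Differentiable ℝ f := hf.differentiable (by norm_num)
  have hcont : ContinuousAt (unitGradient (graphHeight e f)) p := by
    refine continuousAt_unitGradient ?_ (fderiv_graphHeight_ne_zero e hdf.differentiableAt)
    rw [fderiv_graphHeight e hdf]
    exact (continuous_const.sub (((hf.continuous_fderiv (by norm_num)).comp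
      (contDiff_chart_fst (n := 0) e).continuous).clm_comp continuous_const)).continuousAt
  refine (hcont.comp continuous_subtype_val.continuousAt).congr ?_
  filter_upwards [continuous_subtype_val.continuousAt.preimage_mem_nhds (hW.mem_nhds hpW)]
    with x hx
  exact (D.normal_eq_unitGradient hf hW h x hx).symm

theorem exists_extension_normal (hα : 0 < α) (hα1 : α ≤ 1) (p : D.Γ) :
    ∃ N : E3 → E3, C1HolderAt α N p ∧ ∀ᶠ x : D.Γ in 𝓝 p, D.normal x = N x := by
  obtain ⟨e, f, W, hf, hfα, hW, hpW, h⟩ := D.local_graph p p.2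
  refine ⟨unitGradient (graphHeight e f), .unitGradient
    (c1HolderAt_fderiv_graphHeight e hf hfα hα hα1 p)
    (fderiv_graphHeight_ne_zero e (hf.differentiable (by norm_num)).differentiableAt) hα hα1, ?_⟩
  filter_upwards [continuous_subtype_val.continuousAt.preimage_mem_nhds (hW.mem_nhds hpW)]
    with x hx
  exact D.normal_eq_unitGradient hf hW h x hx

end HolderDomain

theorem IsUpperAhlforsRegular.of_forall_exists_nhds_restrict {X : Type*} [MetricSpace X]
    [CompactSpace X] [MeasurableSpace X] [BorelSpace X] {μ : Measure X} {d : ℝ}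
    (h : ∀ p, ∃ U ∈ 𝓝 p, IsUpperAhlforsRegular d (μ.restrict U)) : IsUpperAhlforsRegular d μ := by
  rw [← Measure.restrict_univ (μ := μ)]
  refine isCompact_univ.induction_on (p := fun S => IsUpperAhlforsRegular d (μ.restrict S))
    ⟨0, by simp⟩ ?_ ?_ ?_
  · rintro S T hST ⟨C, hC⟩
    exact ⟨C, fun x r hr => (Measure.restrict_mono hST le_rfl _).trans (hC x r hr)⟩
  · rintro S T ⟨C, hC⟩ ⟨C', hC'⟩
    refine ⟨max C 0 + max C' 0, fun x r hr => ?_⟩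
    rw [add_mul, ENNReal.ofReal_add (by positivity) (by positivity)]
    refine (Measure.restrict_union_le S T _).trans (add_le_add ((hC x r hr).trans ?_)
      ((hC' x r hr).trans ?_))
    all_goals gcongr; exact le_max_left _ _
  · intro p _
    obtain ⟨U, hU, hreg⟩ := h p
    exact ⟨U, nhdsWithin_le_nhds hU, hreg⟩

theorem euclideanHausdorffMeasure_le_image_of_antilipschitzWith {X Y : Type*} [MetricSpace X]
    [MeasurableSpace X] [BorelSpace X] [MetricSpace Y] [MeasurableSpace Y] [BorelSpace Y]
    {K : ℝ≥0} {f : X → Y} (hf : AntilipschitzWith K f) (d : ℕ) (S : Set X) :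
    (μHE[d] : Measure X) S ≤ (K : ℝ≥0∞) ^ d * (μHE[d] : Measure Y) (f '' S) := by
  simp only [Measure.euclideanHausdorffMeasure_def, Measure.smul_apply, ENNReal.smul_def,
    smul_eq_mul]
  rw [mul_left_comm]
  gcongr
  simpa using hf.le_hausdorffMeasure_image d.cast_nonneg S

theorem isUpperAhlforsRegular_restrict_of_antilipschitzWith {X : Type*} [MetricSpace X]
    [MeasurableSpace X] [BorelSpace X] {d : ℕ} {π : X → EuclideanSpace ℝ (Fin d)} {L K : ℝ≥0}
    {U : Set X} (hπ : LipschitzWith L π) (hU : AntilipschitzWith K (U.domRestrict π)) :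
    IsUpperAhlforsRegular d ((μHE[d] : Measure X).restrict U) := by
  set V : ℝ≥0∞ := volume (Metric.closedBall (0 : EuclideanSpace ℝ (Fin d)) 1) with hV
  refine ⟨(K : ℝ) ^ d * L ^ d * V.toReal, fun x r hr => ?_⟩
  have himage : U.domRestrict π '' (Subtype.val ⁻¹' Metric.closedBall x r) ⊆
      Metric.closedBall (π x) (L * r) := by
    rintro _ ⟨y, hy, rfl⟩
    exact hπ.mapsTo_closedBall x r hy
  calc (μHE[d] : Measure X).restrict U (Metric.closedBall x r)
      = μHE[d] ((↑) ⁻¹' Metric.closedBall x r : Set U) := by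
        rw [Measure.restrict_apply Metric.isClosed_closedBall.measurableSet,
          ← (isometry_subtype_coe (s := U)).euclideanHausdorffMeasure_image,
          Subtype.image_preimage_coe, Set.inter_comm]
    _ ≤ (K : ℝ≥0∞) ^ d * volume (Metric.closedBall (π x) (L * r)) := by
        rw [← EuclideanSpace.euclideanHausdorffMeasure_eq_volume]
        exact (euclideanHausdorffMeasure_le_image_of_antilipschitzWith hU d _).trans (by gcongr)
    _ = ENNReal.ofReal ((K : ℝ) ^ d * L ^ d * V.toReal * r ^ (d : ℝ)) := by
        rw [Measure.addHaar_closedBall' _ _ (by positivity), finrank_euclideanSpace_fin, ← hV,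
          Real.rpow_natCast, mul_right_comm, mul_assoc ((K : ℝ) ^ d), ← mul_pow,
          ENNReal.ofReal_mul (by positivity), ENNReal.ofReal_mul (by positivity),
          ENNReal.ofReal_toReal measure_closedBall_lt_top.ne, ENNReal.ofReal_pow K.coe_nonneg,
          ENNReal.ofReal_coe_nnreal, mul_assoc]

theorem lipschitzWith_chart_fst (e : E3 ≃ᵃⁱ[ℝ] WithLp 2 (E2 × ℝ)) :
    LipschitzWith 1 fun z => (e z).fst := .mk_one fun x y => by
  rw [← e.dist_map, dist_eq_norm, dist_eq_norm]
  exact WithLp.norm_fst_le _ (e x - e y)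

theorem dist_le_chart_fst_add_chart_snd (e : E3 ≃ᵃⁱ[ℝ] WithLp 2 (E2 × ℝ)) (x y : E3) :
    dist x y ≤ dist (e x).fst (e y).fst + dist (e x).snd (e y).snd := by
  rw [← e.dist_map, WithLp.prod_dist_eq_of_L2, Real.sqrt_le_left (by positivity), add_sq]
  linarith [mul_nonneg (dist_nonneg (x := (e x).fst) (y := (e y).fst))
    (dist_nonneg (x := (e x).snd) (y := (e y).snd))]

namespace HolderDomain

variable {α : ℝ≥0} (D : HolderDomain α)

theorem exists_antilipschitzWith_chart (p : D.Γ) :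
    ∃ (π : D.Γ → E2) (U : Set D.Γ) (K : ℝ≥0), LipschitzWith 1 π ∧ U ∈ 𝓝 p ∧
      AntilipschitzWith K (U.domRestrict π) := by
  obtain ⟨e, f, W, hf, -, hW, hpW, h⟩ := D.local_graph p p.2
  let π : D.Γ → E2 := fun y => (e y).fst
  have hπ : LipschitzWith 1 π := .mk_one fun y z =>
    (lipschitzWith_chart_fst e).dist_le_mul y z |>.trans (by simp [Subtype.dist_eq])
  obtain ⟨K, t, ht, hK⟩ :=
    (hf.of_le (by norm_num)).contDiffAt.exists_lipschitzOnWith (x := π p)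
  refine ⟨π, {y | (y : E3) ∈ W ∧ π y ∈ t}, K + 1, hπ, ?_, ?_⟩
  · exact inter_mem (continuous_subtype_val.continuousAt.preimage_mem_nhds (hW.mem_nhds hpW))
      (hπ.continuous.continuousAt.preimage_mem_nhds ht)
  · refine .of_le_mul_dist fun ⟨y, hyW, hyt⟩ ⟨z, hzW, hzt⟩ => ?_
    have hgraph {y : D.Γ} (hy : (y : E3) ∈ W) : (e y).snd = f (π y) :=
      (D.mem_frontier_of_graph hf.continuous hW h hy).1.mp y.2
    calc dist (y : E3) z ≤ dist (π y) (π z) + dist (f (π y)) (f (π z)) := by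
          rw [← hgraph hyW, ← hgraph hzW]
          exact dist_le_chart_fst_add_chart_snd e y z
      _ ≤ dist (π y) (π z) + K * dist (π y) (π z) := by
          gcongr
          exact hK.dist_le_mul _ hyt _ hzt
      _ = ((K + 1 : ℝ≥0) : ℝ) * dist (π y) (π z) := by push_cast; ring

theorem isUpperAhlforsRegular_surfaceMeasure : IsUpperAhlforsRegular 2 D.surfaceMeasure :=
  .of_forall_exists_nhds_restrict fun p =>
    let ⟨_, U, _, hπ, hU, hK⟩ := D.exists_antilipschitzWith_chart p
    ⟨U, hU, isUpperAhlforsRegular_restrict_of_antilipschitzWith hπ hK⟩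

end HolderDomain

theorem LocHolderAt.comp_subtype_val {X Y : Type*} [PseudoMetricSpace X] [PseudoMetricSpace Y]
    {r : ℝ≥0} {f : X → Y} {s : Set X} {p : s} (hf : LocHolderAt r f p) :
    LocHolderAt r (fun x : s => f x) p := by
  have h := hf.comp (of_lipschitzWith (LipschitzWith.subtype_val s)) continuousAt_subtype_val
  rwa [mul_one] at h

theorem cdot_toC3 (v n : E3) : cdot v (toC3 n) = ((inner ℝ n v : ℝ) : ℂ) := by
  simp [cdot, toC3, PiLp.inner_apply]

theorem cdot_clm_single (T : E3 →L[ℝ] ℂ) (v : E3) :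
    cdot v (fun k => T (EuclideanSpace.single k (1 : ℝ))) = T v := by
  have hv : v = ∑ k, v k • EuclideanSpace.single k (1 : ℝ) := by
    ext i
    simp [Pi.single_apply]
  conv_rhs => rw [hv, map_sum]
  simp [cdot]

theorem norm_cdot_le (v : E3) (g : Fin 3 → ℂ) : ‖cdot v g‖ ≤ (∑ k, ‖g k‖) * ‖v‖ := by
  rw [Finset.sum_mul]
  refine norm_sum_le_of_le _ fun k _ => ?_
  rw [norm_mul, Complex.norm_real, mul_comm]
  gcongr
  exact PiLp.norm_apply_le v k

theorem isLittleO_integral_of_dominated {X Y E G : Type*} [NormedAddCommGroup E]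
    [NormedAddCommGroup G] [NormedSpace ℝ G] [MeasurableSpace Y] {μ : Measure Y} {l : Filter X}
    [l.IsCountablyGenerated] {F : X → Y → G} {ρ : X → E} {bound : Y → ℝ}
    (hF : ∀ x, AEStronglyMeasurable (F x) μ)
    (hbound : ∀ᵐ y ∂μ, ∀ x, ‖F x y‖ ≤ bound y * ‖ρ x‖) (hint : Integrable bound μ)
    (hlim : ∀ᵐ y ∂μ, (F · y) =o[l] ρ) : (fun x => ∫ y, F x y ∂μ) =o[l] ρ := by
  suffices h : (fun x => ∫ y, ‖F x y‖ ∂μ) =o[l] fun x => ‖ρ x‖ from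
    (IsBigO.of_norm_le fun x => norm_integral_le_integral_norm (F x)).trans_isLittleO
      h.of_norm_right
  refine (isLittleO_iff_tendsto fun x hx => ?_).mpr ?_
  · refine integral_eq_zero_of_ae (hbound.mono fun y hy => ?_)
    simpa [hx] using hy x
  · simp_rw [← integral_div]
    rw [← integral_zero Y ℝ (μ := μ)]
    refine tendsto_integral_filter_of_dominated_convergence (fun y => |bound y|)
      (.of_forall fun x => by fun_prop) (.of_forall fun x => ?_) hint.abs ?_
    · filter_upwards [hbound] with y hy
      rw [norm_div, norm_norm, norm_norm]
      exact div_le_of_le_mul₀ (norm_nonneg _) (abs_nonneg _)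
        ((hy x).trans (by gcongr; exact le_abs_self _))
    · filter_upwards [hlim] with y hy
      exact hy.norm_norm.tendsto_div_nhds_zero

namespace HolderDomain

variable {α : ℝ≥0} (D : HolderDomain α)

/-- `f(y) = f(x) + g · (y - x) + o(|y - x|)` as `y → x` on `Γ`, where `g` need not be tangential.
Such an ambient gradient is not unique, but its tangential part is the surface gradient. -/
def HasAmbientGradientAt (f : D.Γ → ℂ) (g : Fin 3 → ℂ) (x : D.Γ) : Prop :=
  (fun y : D.Γ => f y - f x - cdot ((y : E3) - x) g) =o[𝓝 x] (fun y : D.Γ => (y : E3) - x)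

/-- The tangential part `g - (ν(x) · g) ν(x)` of a vector `g`. -/
noncomputable def tangentialPart (x : D.Γ) (g : Fin 3 → ℂ) : Fin 3 → ℂ :=
  g - cdot (D.normal x) g • toC3 (D.normal x)

variable {D} {f h : D.Γ → ℂ} {a b : Fin 3 → ℂ} {x : D.Γ}

namespace HasAmbientGradientAt

theorem hasSurfaceGradientAt (hf : D.HasAmbientGradientAt f a x) :
    D.HasSurfaceGradientAt f (D.tangentialPart x a) x := by
  obtain ⟨hunit, horth, -⟩ := D.normal_spec x
  have hcdot : ∀ v, cdot v (D.tangentialPart x a) =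
      cdot v a - cdot (D.normal x) a * ((inner ℝ (D.normal x) v : ℝ) : ℂ) := fun v => by
    rw [tangentialPart, cdot_sub_right, cdot_smul_right, cdot_toC3]
  refine ⟨by rw [hcdot, real_inner_self_eq_norm_sq, hunit]; simp, ?_⟩
  have horth' : (fun y : D.Γ => ((inner ℝ (D.normal x) ((y : E3) - x) : ℝ) : ℂ)) =o[𝓝 x]
      (fun y : D.Γ => (y : E3) - x) := by
    rw [nhdsWithin_eq_map_subtype_coe x.2, isLittleO_map] at horth
    refine IsLittleO.of_norm_left ?_
    simp only [Complex.norm_real]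
    exact horth.norm_left
  refine (hf.add (horth'.const_mul_left (cdot (D.normal x) a))).congr_left fun y => ?_
  rw [hcdot]
  ring

theorem mul (hf : D.HasAmbientGradientAt f a x) (hh : D.HasAmbientGradientAt h b x)
    (hcont : ContinuousAt h x) :
    D.HasAmbientGradientAt (fun y => f y * h y) (h x • a + f x • b) x := by
  have hfst : (fun y : D.Γ => (f y - f x - cdot ((y : E3) - x) a) * h y) =o[𝓝 x]
      (fun y : D.Γ => (y : E3) - x) := by
    simpa using hf.norm_right.mul_isBigO (hcont.isBigO_one ℝ)
  have hsnd : (fun y : D.Γ => cdot ((y : E3) - x) a * (h y - h x)) =o[𝓝 x]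
      (fun y : D.Γ => (y : E3) - x) := by
    have hcdot : (fun y : D.Γ => cdot ((y : E3) - x) a) =O[𝓝 x] fun y : D.Γ => ‖(y : E3) - x‖ :=
      IsBigO.of_bound _ (.of_forall fun y => by rw [norm_norm]; exact norm_cdot_le _ a)
    have hsub : (fun y : D.Γ => h y - h x) =o[𝓝 x] (fun _ => (1 : ℝ)) :=
      (isLittleO_one_iff ℝ).mpr (by simpa using hcont.tendsto.sub_const (h x))
    simpa using hcdot.mul_isLittleO hsub
  refine ((hfst.add hsnd).add (hh.const_mul_left (f x))).congr_left fun y => ?_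
  rw [cdot_add_right, cdot_smul_right, cdot_smul_right]
  ring

theorem mul_const (hf : D.HasAmbientGradientAt f a x) (c : ℂ) :
    D.HasAmbientGradientAt (fun y => f y * c) (fun k => a k * c) x := by
  have hsmul : (fun k => a k * c) = c • a := funext fun k => mul_comm _ _
  refine (IsLittleO.const_mul_left hf c).congr_left fun y => ?_
  rw [hsmul, cdot_smul_right]
  ring

theorem of_hasFDerivAt {Q : E3 → ℂ} {T : E3 →L[ℝ] ℂ} (hQ : HasFDerivAt Q T x)
    (hf : ∀ᶠ y : D.Γ in 𝓝 x, f y = Q y) :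
    D.HasAmbientGradientAt f (fun k => T (EuclideanSpace.single k 1)) x := by
  refine (hQ.isLittleO.comp_tendsto (continuous_subtype_val.tendsto x)).congr' ?_ EventuallyEq.rfl
  filter_upwards [hf] with y hy
  rw [hy, hf.self_of_nhds, cdot_clm_single]
  rfl

theorem integral {Y : Type*} [MeasurableSpace Y] {μ : Measure Y} {K : D.Γ → Y → ℂ}
    {G : Fin 3 → Y → ℂ} {bound : Y → ℝ} (hK : ∀ x', Integrable (K x') μ)
    (hG : ∀ k, Integrable (G k) μ) (hbound : Integrable bound μ)
    (hlip : ∀ᵐ y ∂μ, ∀ x' : D.Γ, ‖K x' y - K x y‖ ≤ bound y * ‖(x' : E3) - x‖)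
    (hgrad : ∀ᵐ y ∂μ, D.HasAmbientGradientAt (K · y) (fun k => G k y) x) :
    D.HasAmbientGradientAt (fun x' => ∫ y, K x' y ∂μ) (fun k => ∫ y, G k y ∂μ) x := by
  have hcdot : ∀ v, Integrable (fun y => cdot v fun k => G k y) μ := fun v =>
    integrable_finsetSum _ fun k _ => (hG k).const_mul _
  have hcdot_integral : ∀ v, ∫ y, cdot v (fun k => G k y) ∂μ = cdot v fun k => ∫ y, G k y ∂μ :=
    fun v => by
      simp only [cdot]
      rw [integral_finsetSum _ fun k _ => (hG k).const_mul _]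
      simp_rw [integral_const_mul]
  have hrem : ∀ x', Integrable
      (fun y => K x' y - K x y - cdot ((x' : E3) - x) fun k => G k y) μ := fun x' =>
    ((hK x').sub (hK x)).sub (hcdot _)
  refine (isLittleO_integral_of_dominated (fun x' => (hrem x').aestronglyMeasurable) ?_
    (hbound.add (integrable_finsetSum Finset.univ fun k _ => (hG k).norm))
    hgrad).congr_left fun x' => ?_
  · filter_upwards [hlip] with y hy x'
    rw [Pi.add_apply, add_mul]
    exact (norm_sub_le _ _).trans (add_le_add (hy x') (norm_cdot_le _ _))
  · rw [← hcdot_integral, ← integral_sub (hK x') (hK x)]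
    exact integral_sub ((hK x').sub (hK x)) (hcdot _)

end HasAmbientGradientAt

theorem locHolderAt_normal (hα : 0 < α) (hα1 : α ≤ 1) (p : D.Γ) : LocHolderAt α D.normal p := by
  obtain ⟨N, hN, hν⟩ := D.exists_extension_normal hα hα1 p
  exact ((LocHolderAt.of_contDiffAt hN.contDiffAt).of_le hα1).comp_subtype_val.congr
    (hν.mono fun x hx => hx.symm)

theorem exists_holderC0_normal (hα : 0 < α) (hα1 : α ≤ 1) (k : Fin 3) :
    ∃ n : HolderC0 D.Γ α, ∀ x, n x = (D.normal x k : ℂ) :=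
  HolderC0.exists_of_memHolder hα <| LocHolderAt.memHolder hα fun p =>
    LocHolderAt.contDiffAt_comp (f := D.normal)
      (Complex.ofRealCLM ∘L (EuclideanSpace.proj k : E3 →L[ℝ] ℝ)).contDiff.contDiffAt
      (locHolderAt_normal hα hα1 p) hα

theorem locHolderAt_tangentialPart (hα : 0 < α) (hα1 : α ≤ 1) {Q : E3 → ℂ} {p : D.Γ}
    (hQ : C1HolderAt α Q p) (k : Fin 3) :
    LocHolderAt α (fun x : D.Γ => D.tangentialPart x
      (fun j => fderiv ℝ Q x (EuclideanSpace.single j 1)) k) p := by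
  let Φ : (E3 →L[ℝ] ℂ) × E3 → ℂ := fun z =>
    z.1 (EuclideanSpace.single k 1) - z.1 z.2 * Complex.ofRealCLM (z.2 k)
  have hΦ : ContDiff ℝ 1 Φ := by fun_prop
  refine (LocHolderAt.contDiffAt_comp hΦ.contDiffAt (hQ.fderiv.comp_subtype_val.prodMk
    (locHolderAt_normal hα hα1 p)) hα).congr (.of_forall fun x => ?_)
  simp only [tangentialPart, cdot_clm_single]
  rfl

theorem exists_holderC1_of_extension (hα : 0 < α) (hα1 : α ≤ 1)
    (hf : ∀ p : D.Γ, ∃ Q : E3 → ℂ, C1HolderAt α Q p ∧ ∀ᶠ x : D.Γ in 𝓝 p, f x = Q x) :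
    ∃ q : D.HolderC1, (∀ x, q x = f x) ∧ ∃ L, LipschitzWith L q := by
  choose Q hQ hfQ using hf
  have hgrad : ∀ p, ∀ᶠ x : D.Γ in 𝓝 p, D.HasSurfaceGradientAt f
      (D.tangentialPart x fun k => fderiv ℝ (Q p) x (EuclideanSpace.single k 1)) x := by
    intro p
    filter_upwards [continuous_subtype_val.continuousAt.eventually
      ((hQ p).contDiffAt.eventually (by norm_num)), (hfQ p).eventually_nhds] with x hx hfx
    exact (HasAmbientGradientAt.of_hasFDerivAt
      (hx.differentiableAt (by norm_num)).hasFDerivAt hfx).hasSurfaceGradientAt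
  choose g hg using fun p => (⟨_, (hgrad p).self_of_nhds⟩ : ∃ g, D.HasSurfaceGradientAt f g p)
  have hgloc : ∀ k p, LocHolderAt α (fun x => g x k) p := fun k p =>
    (locHolderAt_tangentialPart hα hα1 (hQ p) k).congr
      ((hgrad p).mono fun x hx => congrFun (hx.unique (hg x)) k)
  choose G hG using fun k =>
    HolderC0.exists_of_memHolder hα (LocHolderAt.memHolder hα (hgloc k))
  have hGgrad : ∀ x, D.HasSurfaceGradientAt f (fun k => G k x) x := fun x => by
    simpa only [hG] using hg x
  obtain ⟨L, hL⟩ := LocHolderAt.memHolder one_pos fun p =>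
    (LocHolderAt.of_contDiffAt (hQ p).contDiffAt).comp_subtype_val.congr
      ((hfQ p).mono fun x hx => hx.symm)
  rw [holderWith_one] at hL
  exact ⟨⟨WithLp.toLp 1 (⟨f, hL.continuous⟩, WithLp.toLp 1 G), hGgrad⟩, fun _ => rfl, L, hL⟩

theorem exists_holderC1_comp_normal (hα : 0 < α) (hα1 : α ≤ 1) {Ψ : E3 → ℂ}
    (hΨ : ContDiff ℝ 2 Ψ) :
    ∃ q : D.HolderC1, (∀ x, q x = Ψ (D.normal x)) ∧ ∃ L, LipschitzWith L q := by
  refine exists_holderC1_of_extension hα hα1 fun p => ?_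
  obtain ⟨N, hN, hν⟩ := D.exists_extension_normal hα hα1 p
  exact ⟨Ψ ∘ N, (C1HolderAt.of_contDiffAt hΨ.contDiffAt hα1).comp hN hα,
    hν.mono fun x hx => congrArg Ψ hx⟩

theorem HolderC1.exists_clm {E : Type*} [NormedAddCommGroup E] [NormedSpace ℂ E] (hα : 0 < α)
    (hα1 : α ≤ 1) (S : E →L[ℂ] C(D.Γ, ℂ)) (G : Fin 3 → E →L[ℂ] HolderC0 D.Γ α)
    (hG : ∀ u x, D.HasAmbientGradientAt (S u) (fun k => G k u x) x) :
    ∃ T : E →L[ℂ] D.HolderC1, ∀ u x, T u x = S u x := by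
  choose n hn using fun k => exists_holderC0_normal (D := D) hα hα1 k
  choose N hN using fun k => HolderC0.exists_mulCLM hα (n k)
  let P : Fin 3 → E →L[ℂ] HolderC0 D.Γ α := fun k =>
    G k - N k ∘L ∑ j, N j ∘L G j
  let F : E →L[ℂ] WithLp 1 (C(D.Γ, ℂ) × HolderC0Vec D.Γ α) :=
    (WithLp.prodContinuousLinearEquiv 1 ℂ _ _).symm.toContinuousLinearMap ∘L
      S.prod ((PiLp.continuousLinearEquiv 1 ℂ _).symm.toContinuousLinearMap ∘L
        ContinuousLinearMap.pi P)
  have hP : ∀ u x, (fun k => P k u x) = D.tangentialPart x (fun k => G k u x) := fun u x => by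
    ext k
    simp only [P, tangentialPart, cdot, Fin.sum_univ_three]
    change G k u x - N k (N 0 (G 0 u) + N 1 (G 1 u) + N 2 (G 2 u)) x = _
    simp only [hN, hn, HolderC0.toCont_add, ContinuousMap.add_apply, Pi.sub_apply, Pi.smul_apply,
      smul_eq_mul, toC3, mul_comm]
  refine ⟨F.codRestrict D.holderC1Submodule fun u x => ?_, fun u x => rfl⟩
  have hsurf := (hG u x).hasSurfaceGradientAt
  rw [← hP] at hsurf
  exact hsurf

end HolderDomain

namespace HolderDomain

variable {α : ℝ≥0} {D : HolderDomain α}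

theorem norm_coe_sub_coe (x y : D.Γ) : ‖(x : E3) - y‖ = dist x y :=
  (dist_eq_norm (x : E3) y).symm

theorem laplaceKernel_eq (x y : D.Γ) :
    D.laplaceKernel x y = ((1 / (4 * Real.pi) : ℝ) : ℂ) * invDist x y := by
  rw [laplaceKernel, invDist, ← Complex.ofReal_mul, norm_coe_sub_coe, ← one_div (dist x y),
    div_mul_div_comm, one_mul]

theorem integrable_laplaceKernel_mul (u : C(D.Γ, ℂ)) (x : D.Γ) :
    Integrable (fun y => D.laplaceKernel x y * u y) D.surfaceMeasure := by
  simp_rw [laplaceKernel_eq, mul_assoc]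
  exact (IsSingularKernel.invDist.integrable_mul D.isUpperAhlforsRegular_surfaceMeasure
    (by norm_num) u x).const_mul _

/-- The commutator `[p, S₀] ψ = p S₀ ψ - S₀ (p ψ)` of the multiplication by `p` and `S₀`. -/
noncomputable def commutator (p ψ : C(D.Γ, ℂ)) (x : D.Γ) : ℂ :=
  p x * D.singleLayer ψ x - D.singleLayer (p * ψ : C(D.Γ, ℂ)) x

theorem integrable_commutator (p ψ : C(D.Γ, ℂ)) (x : D.Γ) :
    Integrable (fun y => (p x - p y) * (D.laplaceKernel x y * ψ y)) D.surfaceMeasure := by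
  simp_rw [sub_mul, mul_left_comm (p _) (D.laplaceKernel x _)]
  exact (integrable_laplaceKernel_mul (p x • ψ) x).sub (integrable_laplaceKernel_mul (p * ψ) x)

theorem commutator_eq_integral (p ψ : C(D.Γ, ℂ)) (x : D.Γ) :
    commutator p ψ x = ∫ y, (p x - p y) * (D.laplaceKernel x y * ψ y) ∂D.surfaceMeasure := by
  simp only [commutator, singleLayer, sub_mul]
  rw [← integral_const_mul, ← integral_sub ((integrable_laplaceKernel_mul ψ x).const_mul _)
    (integrable_laplaceKernel_mul (p * ψ) x)]
  simp only [ContinuousMap.mul_apply, mul_left_comm]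

/-- The `k`-th Cartesian coordinate as a function on `Γ`. -/
noncomputable def coord (D : HolderDomain α) (k : Fin 3) (x : D.Γ) : ℂ := ((x : E3) k : ℂ)

theorem lipschitzWith_coord (k : Fin 3) : LipschitzWith 1 (D.coord k) :=
  LipschitzWith.of_dist_le_mul fun x y => by
    rw [dist_eq_norm, coord, coord, ← Complex.ofReal_sub, Complex.norm_real, NNReal.coe_one,
      one_mul, ← norm_coe_sub_coe]
    exact PiLp.norm_apply_le ((x : E3) - (y : E3)) k

theorem hasAmbientGradientAt_invDist {x y : D.Γ} (hxy : x ≠ y) :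
    D.HasAmbientGradientAt (fun x' => invDist x' y)
      (fun k => -((D.coord k x - D.coord k y) * invDist x y ^ 3)) x := by
  have hne : (x : E3) - y ≠ 0 := sub_ne_zero.mpr fun h => hxy (Subtype.ext h)
  have hpos : 0 < ‖(x : E3) - y‖ := norm_pos_iff.mpr hne
  have hnormsq : HasFDerivAt (fun z : E3 => ‖z - y‖ ^ 2) (2 • innerSL ℝ ((x : E3) - y)) x := by
    simpa using ((hasFDerivAt_id (x : E3)).sub_const (y : E3)).norm_sq
  have hinv := (hasDerivAt_inv (Real.sqrt_ne_zero'.mpr (pow_pos hpos 2))).comp_hasFDerivAt (x : E3)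
    (hnormsq.sqrt (pow_pos hpos 2).ne')
  convert HasAmbientGradientAt.of_hasFDerivAt (f := fun x' : D.Γ => invDist x' y)
    (Complex.ofRealCLM.hasFDerivAt.comp (x : E3) hinv)
    (.of_forall fun z => by simp [invDist, norm_coe_sub_coe]) using 1
  funext k
  simp [invDist, coord, ← norm_coe_sub_coe, EuclideanSpace.inner_single_right]
  field_simp

theorem continuousAt_invDist {X : Type*} [MetricSpace X] {x y : X} (hxy : x ≠ y) :
    ContinuousAt (fun x' => invDist x' y) x :=
  Complex.continuous_ofReal.continuousAt.comp
    ((continuous_id.dist continuous_const).continuousAt.inv₀ (dist_pos.mpr hxy).ne')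

/-- The `k`-th component of the ambient gradient in `x` of the kernel `(q x - q y) / |x - y|`. -/
noncomputable def gradKernel (q : D.HolderC1) (k : Fin 3) (x y : D.Γ) : ℂ :=
  q.grad k x * invDist x y - diffQuot q x y * diffQuot (D.coord k) x y * invDist x y

theorem hasAmbientGradientAt_diffQuot (q : D.HolderC1) {x y : D.Γ} (hxy : x ≠ y) :
    D.HasAmbientGradientAt (fun x' => diffQuot q x' y) (fun k => gradKernel q k x y) x := by
  have hsub : D.HasAmbientGradientAt (fun x' => q x' - q y) (q.grad.toFun x) x :=
    (q.hasSurfaceGradientAt x).2.congr_left fun z => by ring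
  have hgrad : (fun k => gradKernel q k x y) = invDist x y • q.grad.toFun x +
      (q x - q y) • fun k => -((D.coord k x - D.coord k y) * invDist x y ^ 3) := by
    funext k
    simp only [gradKernel, diffQuot, Pi.add_apply, Pi.smul_apply, smul_eq_mul, HolderC0Vec.toFun]
    ring
  rw [hgrad]
  exact hsub.mul (hasAmbientGradientAt_invDist hxy) (continuousAt_invDist hxy)

section Commutator

variable {q : D.HolderC1} {L : ℝ≥0}

theorem isSingularKernel_diffQuot_mul_coord (hq : LipschitzWith L q) (k : Fin 3) :
    IsSingularKernel 1
      fun x y : D.Γ => diffQuot q x y * diffQuot (D.coord k) x y * invDist x y :=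
  ((IsSingularKernel.diffQuot hq).mul (IsSingularKernel.diffQuot (lipschitzWith_coord k))).mul
    IsSingularKernel.invDist

theorem integrable_gradKernel_mul (hq : LipschitzWith L q) (ψ : C(D.Γ, ℂ)) (k : Fin 3) (x : D.Γ) :
    Integrable (fun y => gradKernel q k x y * ψ y) D.surfaceMeasure := by
  have hμ := D.isUpperAhlforsRegular_surfaceMeasure
  simp only [gradKernel, sub_mul, mul_assoc (q.grad k x)]
  exact ((IsSingularKernel.invDist.integrable_mul hμ (by norm_num) ψ x).const_mul _).sub
    ((isSingularKernel_diffQuot_mul_coord hq k).integrable_mul hμ (by norm_num) ψ x)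

theorem exists_clm_gradKernel (hq : LipschitzWith L q) (hα : 0 < α) (hα1 : α < 1) (k : Fin 3) :
    ∃ G : C(D.Γ, ℂ) →L[ℂ] HolderC0 D.Γ α,
      ∀ ψ x, G ψ x = ∫ y, gradKernel q k x y * ψ y ∂D.surfaceMeasure := by
  have hμ := D.isUpperAhlforsRegular_surfaceMeasure
  have hs : ((1 : ℕ) : ℝ) + α < 2 := by
    push_cast
    linarith [NNReal.coe_lt_one.mpr hα1]
  obtain ⟨V, hV⟩ := IsSingularKernel.invDist.exists_clm_holderC0 hμ hα hα1.le hs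
  obtain ⟨W, hW⟩ := (isSingularKernel_diffQuot_mul_coord hq k).exists_clm_holderC0 hμ hα hα1.le hs
  obtain ⟨M, hM⟩ := HolderC0.exists_mulCLM hα (q.grad k)
  refine ⟨M ∘L V - W, fun ψ x => ?_⟩
  change M (V ψ) x - W ψ x = _
  simp only [gradKernel, sub_mul, mul_assoc (q.grad k x)]
  rw [integral_sub ((IsSingularKernel.invDist.integrable_mul hμ (by norm_num) ψ x).const_mul _)
      ((isSingularKernel_diffQuot_mul_coord hq k).integrable_mul hμ (by norm_num) ψ x),
    integral_const_mul, hM, hV, hW]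

theorem hasAmbientGradientAt_integral_diffQuot (hq : LipschitzWith L q) (ψ : C(D.Γ, ℂ))
    (x : D.Γ) :
    D.HasAmbientGradientAt (fun x' => ∫ y, diffQuot q x' y * ψ y ∂D.surfaceMeasure)
      (fun k => ∫ y, gradKernel q k x y * ψ y ∂D.surfaceMeasure) x := by
  have hμ := D.isUpperAhlforsRegular_surfaceMeasure
  have hne : ∀ᵐ y ∂D.surfaceMeasure, x ≠ y := by
    filter_upwards [measure_eq_zero_iff_ae_notMem.mp (hμ.measure_singleton two_pos x)] with y hy
    exact Ne.symm hy
  have hbound : Integrable (fun y => 2 * L * ‖invDist x y * ψ y‖) D.surfaceMeasure :=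
    (IsSingularKernel.invDist.integrable_mul hμ (by norm_num) ψ x).norm.const_mul _
  refine HasAmbientGradientAt.integral
    ((IsSingularKernel.diffQuot hq).integrable_mul hμ (by norm_num) ψ)
    (fun k => integrable_gradKernel_mul hq ψ k x) hbound ?_ ?_
  · filter_upwards [hne] with y hxy x'
    rw [← sub_mul, norm_mul, norm_mul, norm_invDist, norm_coe_sub_coe, norm_sub_rev, dist_comm x' x]
    calc _ ≤ 2 * L * dist x x' * (dist x y)⁻¹ * ‖ψ y‖ := by
          gcongr
          exact norm_diffQuot_sub_le hq hxy x'
      _ = _ := by ring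
  · filter_upwards [hne] with y hxy
    exact (hasAmbientGradientAt_diffQuot q hxy).mul_const (ψ y)

theorem exists_clm_commutator (hq : LipschitzWith L q) (hα : 0 < α) (hα1 : α < 1) :
    ∃ T : C(D.Γ, ℂ) →L[ℂ] D.HolderC1, ∀ ψ x,
      T ψ x = commutator q.toCont ψ x := by
  have hs : ((0 : ℕ) : ℝ) + α < 2 := by
    push_cast
    linarith [NNReal.coe_lt_one.mpr hα1]
  obtain ⟨S, hS⟩ := (IsSingularKernel.diffQuot hq).exists_clm_holderC0
    D.isUpperAhlforsRegular_surfaceMeasure hα hα1.le hs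
  choose G hG using exists_clm_gradKernel hq hα hα1
  obtain ⟨T, hT⟩ := HolderC1.exists_clm hα hα1.le (HolderC0.toContCLM D.Γ α ∘L S) G fun ψ x => by
    have hSψ : ⇑((HolderC0.toContCLM D.Γ α ∘L S) ψ) =
        fun x' => ∫ y, diffQuot q x' y * ψ y ∂D.surfaceMeasure := funext (hS ψ)
    simp only [hSψ, hG]
    exact hasAmbientGradientAt_integral_diffQuot hq ψ x
  refine ⟨((1 / (4 * Real.pi) : ℝ) : ℂ) • T, fun ψ x => ?_⟩
  have hkernel : ∀ y, (q x - q y) * (D.laplaceKernel x y * ψ y) =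
      ((1 / (4 * Real.pi) : ℝ) : ℂ) * (diffQuot q x y * ψ y) := fun y => by
    rw [laplaceKernel_eq, diffQuot]
    ring
  simp_rw [commutator_eq_integral, hkernel, integral_const_mul]
  exact congrArg (((1 / (4 * Real.pi) : ℝ) : ℂ) * ·) ((hT ψ x).trans (hS ψ x))

end Commutator

end HolderDomain

theorem HolderC0.exists_isCompactOperator_of_matrix {X : Type} [MetricSpace X] [CompactSpace X]
    {α : ℝ≥0} {F : Type*} [NormedAddCommGroup F] [NormedSpace ℂ F] (hα : 0 < α)
    (T : Fin 3 → Fin 3 → C(X, ℂ) →L[ℂ] F) :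
    ∃ C : HolderC0Vec X α →L[ℂ] PiLp 1 (fun _ : Fin 3 => F),
      (∀ φ i, C φ i = ∑ j, T i j (φ j).toCont) ∧ IsCompactOperator C := by
  let column (j : Fin 3) : C(X, ℂ) →L[ℂ] PiLp 1 (fun _ : Fin 3 => F) :=
    (PiLp.continuousLinearEquiv 1 ℂ _).symm.toContinuousLinearMap ∘L
      ContinuousLinearMap.pi fun i => T i j
  let C (j : Fin 3) : HolderC0Vec X α →L[ℂ] PiLp 1 (fun _ : Fin 3 => F) :=
    column j ∘L toContCLM X α ∘L PiLp.proj 1 (fun _ : Fin 3 => HolderC0 X α) j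
  have hC : ∀ j, IsCompactOperator (C j) := fun j =>
    ((isCompactOperator_toContCLM hα).comp_clm
      (PiLp.proj 1 (fun _ : Fin 3 => HolderC0 X α) j)).clm_comp (column j)
  refine ⟨C 0 + C 1 + C 2, fun φ i => ?_, ((hC 0).add (hC 1)).add (hC 2)⟩
  rw [Fin.sum_univ_three]
  rfl

namespace HolderDomain

variable {α : ℝ≥0} {D : HolderDomain α}

theorem HolderC1.sum_apply {ι : Type*} (s : Finset ι) (f : ι → D.HolderC1) (x : D.Γ) :
    (∑ i ∈ s, f i) x = ∑ i ∈ s, f i x := by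
  classical
  induction s using Finset.induction_on with
  | empty => rfl
  | insert i s hi ih =>
    rw [Finset.sum_insert hi, Finset.sum_insert hi, ← ih]
    rfl

/-- The `k`-th component of the normal as a continuous function. -/
noncomputable def normalCont (D : HolderDomain α) (k : Fin 3) : C(D.Γ, ℂ) :=
  ⟨fun x => (D.normal x k : ℂ), by have := D.continuous_normal; fun_prop⟩

theorem exists_clm_commutator_comp_normal (hα : 0 < α) (hα1 : α < 1) {p : C(D.Γ, ℂ)} {Ψ : E3 → ℂ}
    (hΨ : ContDiff ℝ 2 Ψ) (hp : ∀ x, p x = Ψ (D.normal x)) :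
    ∃ T : C(D.Γ, ℂ) →L[ℂ] D.HolderC1, ∀ ψ x, T ψ x = commutator p ψ x := by
  obtain ⟨q, hq, L, hL⟩ := exists_holderC1_comp_normal (D := D) hα hα1.le hΨ
  obtain rfl : q.toCont = p := ContinuousMap.ext fun x => (hq x).trans (hp x).symm
  exact exists_clm_commutator hL hα hα1

theorem contDiff_ofReal_apply (k : Fin 3) : ContDiff ℝ 2 fun v : E3 => (v k : ℂ) :=
  (Complex.ofRealCLM ∘L (EuclideanSpace.proj k : E3 →L[ℝ] ℝ)).contDiff

section Normal

variable (φ : HolderC0Vec D.Γ α) (x : D.Γ)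

/-- The function `ν · φ` as a continuous function. -/
noncomputable def normalDotCont : C(D.Γ, ℂ) := ∑ j, D.normalCont j * (φ j).toCont

theorem coe_normalDotCont : ⇑(normalDotCont φ) = D.normalDot φ.toFun := by
  funext y
  simp only [normalDotCont, ContinuousMap.sum_apply, ContinuousMap.mul_apply]
  rfl

theorem commNormal_apply (i : Fin 3) :
    D.commNormal φ.toFun x i = commutator (D.normalCont i) (normalDotCont φ) x := by
  have hproj : (fun y => D.projNormal φ.toFun y i) =
      ⇑(D.normalCont i * normalDotCont φ : C(D.Γ, ℂ)) := by
    rw [ContinuousMap.coe_mul, coe_normalDotCont]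
    exact funext fun y => mul_comm _ _
  simp only [commNormal, commutator, vecSingleLayer, hproj, coe_normalDotCont, Pi.sub_apply,
    Pi.smul_apply, smul_eq_mul]
  rw [mul_comm]
  rfl

theorem commNormalIntegrand_apply (y : D.Γ) (i : Fin 3) :
    D.commNormalIntegrand φ.toFun x y i =
      (D.normalCont i x - D.normalCont i y) * (D.laplaceKernel x y * normalDotCont φ y) := by
  rw [coe_normalDotCont]
  simp only [commNormalIntegrand, normalDot, Pi.smul_apply, Pi.sub_apply, smul_eq_mul, toC3,
    normalCont, ContinuousMap.coe_mk]
  ring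

theorem integrable_commNormalIntegrand :
    Integrable (D.commNormalIntegrand φ.toFun x) D.surfaceMeasure :=
  .of_eval fun i => by
    simp only [commNormalIntegrand_apply]
    exact integrable_commutator _ _ x

theorem commNormal_eq_integral :
    D.commNormal φ.toFun x = ∫ y, D.commNormalIntegrand φ.toFun x y ∂D.surfaceMeasure := by
  funext i
  rw [eval_integral fun i => (integrable_commNormalIntegrand φ x).eval i, commNormal_apply,
    commutator_eq_integral]
  simp only [commNormalIntegrand_apply]

variable (D) in
theorem exists_isCompactOperator_commNormal (hα : 0 < α) (hα1 : α < 1) :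
    ∃ C : HolderC0Vec D.Γ α →L[ℂ] D.HolderC1Vec,
      (∀ φ x, (C φ).toFun x = D.commNormal φ.toFun x) ∧ IsCompactOperator C := by
  choose T hT using fun i => exists_clm_commutator_comp_normal (p := D.normalCont i) hα hα1
    (contDiff_ofReal_apply i) fun _ => rfl
  obtain ⟨C, hC, hcompact⟩ := HolderC0.exists_isCompactOperator_of_matrix (α := α) hα fun i j =>
    T i ∘L ContinuousLinearMap.mul ℂ C(D.Γ, ℂ) (D.normalCont j)
  refine ⟨C, fun φ x => funext fun i => ?_, hcompact⟩
  have hCi : C φ i = T i (normalDotCont φ) := by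
    rw [hC, normalDotCont, map_sum]
    rfl
  rw [commNormal_apply, ← hT, ← hCi]
  rfl

end Normal

section Tangential

variable (φ : HolderC0Vec D.Γ α) (x : D.Γ)

theorem projTangential_apply (v : D.Γ → Fin 3 → ℂ) (i : Fin 3) :
    D.projTangential v x i = v x i - ∑ j, (D.normalCont i * D.normalCont j) x * v x j := by
  simp only [projTangential, projNormal, normalDot, cdot, toC3, Pi.sub_apply, Pi.smul_apply,
    smul_eq_mul, Finset.sum_mul, normalCont, ContinuousMap.mul_apply, ContinuousMap.coe_mk]
  congr! 2
  ring

theorem singleLayer_sub_sum (u : C(D.Γ, ℂ)) (v : Fin 3 → C(D.Γ, ℂ)) :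
    D.singleLayer (fun y => u y - ∑ j, v j y) x =
      D.singleLayer u x - ∑ j, D.singleLayer (v j) x := by
  simp only [singleLayer, mul_sub, Finset.mul_sum]
  rw [integral_sub (integrable_laplaceKernel_mul u x)
      (integrable_finsetSum _ fun j _ => integrable_laplaceKernel_mul (v j) x),
    integral_finsetSum _ fun j _ => integrable_laplaceKernel_mul (v j) x]

theorem commTangential_apply (i : Fin 3) :
    D.commTangential φ.toFun x i =
      -∑ j, commutator (D.normalCont i * D.normalCont j) (φ j).toCont x := by
  have hlayer : D.vecSingleLayer (D.projTangential φ.toFun) x i = D.singleLayer (φ i).toCont x -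
      ∑ j, D.singleLayer (D.normalCont i * D.normalCont j * (φ j).toCont : C(D.Γ, ℂ)) x := by
    rw [← singleLayer_sub_sum]
    simp only [vecSingleLayer, projTangential_apply]
    rfl
  rw [commTangential, Pi.sub_apply, hlayer, projTangential_apply]
  simp only [commutator, Finset.sum_sub_distrib, vecSingleLayer, HolderC0Vec.toFun]
  ring

theorem commTangentialIntegrand_apply (y : D.Γ) (i : Fin 3) :
    D.commTangentialIntegrand φ.toFun x y i =
      ∑ j, ((D.normalCont i * D.normalCont j) x - (D.normalCont i * D.normalCont j) y) *
          (D.laplaceKernel x y * (φ j).toCont y) := by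
  simp only [commTangentialIntegrand, Pi.smul_apply, Pi.sub_apply, smul_eq_mul, toC3, normalCont,
    ContinuousMap.coe_mk, ContinuousMap.mul_apply, cdot, HolderC0Vec.toFun, Finset.sum_mul,
    ← Finset.sum_sub_distrib, Finset.mul_sum]
  congr! 1
  ring

theorem integrable_commTangentialIntegrand :
    Integrable (D.commTangentialIntegrand φ.toFun x) D.surfaceMeasure :=
  .of_eval fun i => by
    simp only [commTangentialIntegrand_apply]
    exact integrable_finsetSum _ fun j _ => integrable_commutator _ _ x

theorem commTangential_eq_integral :
    D.commTangential φ.toFun x = -∫ y, D.commTangentialIntegrand φ.toFun x y ∂D.surfaceMeasure := by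
  funext i
  rw [Pi.neg_apply, eval_integral fun i => (integrable_commTangentialIntegrand φ x).eval i,
    commTangential_apply]
  simp only [commTangentialIntegrand_apply, commutator_eq_integral]
  rw [integral_finsetSum _ fun j _ => integrable_commutator _ _ x]

variable (D) in
theorem exists_isCompactOperator_commTangential (hα : 0 < α) (hα1 : α < 1) :
    ∃ C : HolderC0Vec D.Γ α →L[ℂ] D.HolderC1Vec,
      (∀ φ x, (C φ).toFun x = D.commTangential φ.toFun x) ∧ IsCompactOperator C := by
  choose T hT using fun i j => exists_clm_commutator_comp_normal
    (p := D.normalCont i * D.normalCont j) hα hα1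
    ((contDiff_ofReal_apply i).mul (contDiff_ofReal_apply j)) fun _ => rfl
  obtain ⟨C, hC, hcompact⟩ :=
    HolderC0.exists_isCompactOperator_of_matrix (α := α) hα fun i j => -T i j
  refine ⟨C, fun φ x => funext fun i => ?_, hcompact⟩
  rw [HolderC1Vec.toFun, hC, HolderC1.sum_apply, commTangential_apply, ← Finset.sum_neg_distrib]
  exact Finset.sum_congr rfl fun j _ => congrArg Neg.neg (hT i j (φ j).toCont x)

end Tangential

end HolderDomain

theorem mainTheorem7 (α : ℝ≥0) (hα0 : 0 < α) (hα1 : α < 1) (D : HolderDomain α) :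
    -- the single-layer integrals converge absolutely for every continuous density
    (∀ (u : C(D.Γ, ℂ)) (x : D.Γ),
      Integrable (fun y => D.laplaceKernel x y * u y) D.surfaceMeasure) ∧
    -- the integral representations of the two commutators
    (∀ (φ : HolderC0Vec D.Γ α) (x : D.Γ),
      Integrable (D.commNormalIntegrand φ.toFun x) D.surfaceMeasure ∧
      D.commNormal φ.toFun x = ∫ y, D.commNormalIntegrand φ.toFun x y ∂D.surfaceMeasure) ∧
    (∀ (φ : HolderC0Vec D.Γ α) (x : D.Γ),
      Integrable (D.commTangentialIntegrand φ.toFun x) D.surfaceMeasure ∧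
      D.commTangential φ.toFun x =
        -∫ y, D.commTangentialIntegrand φ.toFun x y ∂D.surfaceMeasure) ∧
    -- the two commutators are compact linear maps from `C^{0,α}(Γ, ℂ³)` to `C^{1,α}(Γ, ℂ³)`
    (∃ C : HolderC0Vec D.Γ α →L[ℂ] D.HolderC1Vec,
      (∀ φ x, (C φ).toFun x = D.commNormal φ.toFun x) ∧ IsCompactOperator C) ∧
    (∃ C : HolderC0Vec D.Γ α →L[ℂ] D.HolderC1Vec,
      (∀ φ x, (C φ).toFun x = D.commTangential φ.toFun x) ∧ IsCompactOperator C) := by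
  exact ⟨HolderDomain.integrable_laplaceKernel_mul,
    fun φ x => ⟨HolderDomain.integrable_commNormalIntegrand φ x,
      HolderDomain.commNormal_eq_integral φ x⟩,
    fun φ x => ⟨HolderDomain.integrable_commTangentialIntegrand φ x,
      HolderDomain.commTangential_eq_integral φ x⟩,
    D.exists_isCompactOperator_commNormal hα0 hα1,
    D.exists_isCompactOperator_commTangential hα0 hα1⟩
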